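/- Let $d,n\ge 1$, $\alpha\in(1,2)$, $\sigma>0$, $0<\lambda$, $0<M$, and let $\ell:\mathbb R^d\times\mathcal Z\to\mathbb R$ be a loss such that for every $z\in\mathcal Z$ the function $\ell(\cdot,z)$ is $\lambda$-strongly convex and $M$-smooth (differentiable with $M$-Lipschitz gradient). Put $C_{\alpha,d}=\alpha 2^{\alpha-1}\pi^{-d/2}\,\Gamma(\frac{\alpha+d}{2})/\Gamma(1-\frac{\alpha}{2})$. A probability measure $\mu$ on $\mathbb R^d$ is said to satisfy an $\alpha$-stable Poincaré inequality with constants $(a,b)$, $a,b\ge 0$, if for every differentiable $\mu$-square-integrable $f:\mathbb R^d\to\mathbb R$ $$\int f^2\,d\mu-\Big(\int f\,d\mu\Big)^2\le a\,C_{\alpha,d}\int_{\mathbb R^d\setminus\{0\}}\int_{\mathbb R^d}\frac{(f(x)-f(x+z))^2}{\|z\|^{d+\alpha}}\,d\mu(x)\,dz+b\int\|\nabla f\|^2\,d\mu .$$ Let $S=(z_1,\dots,z_n)\in\mathcal Z^n$, let $(B_k)_{k\ge 0}$ be a fixed (non-random) sequence of subsets of $\{1,\dots,n\}$ of common size $b\ge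 1$ (for $b=n$: full-batch gradient descent), and for a step size $\eta>0$ consider heavy-tailed gradient descent without projection, $$X_{k+1}=X_k-\frac{\eta}{b}\sum_{i\in B_k}\nabla\ell(X_k,z_i)+\sigma\eta^{1/\alpha}\xi_k,\qquad k\ge 0,$$ where $(\xi_k)_{k\ge0}$ are i.i.d. with characteristic function $t\mapsto e^{-\|t\|^\alpha}$ and independent of $X_0$. Assume $$\frac{\lambda}{M}\Big(1+\frac{\alpha}{d}\Big)>1,$$ and let $$F(\eta)=\frac{(1-\eta\lambda)^{\alpha+d}}{(1-\eta M)^{d}},\qquad \eta_0=\frac{(\alpha+d)\lambda-dM}{\alpha\lambda M},$$ where, if $\lambda=M$ (so that $\eta_0=1/M$), $F(\eta_0)$ is read as its limit value $0$. Then: 1. $F(\eta_0)<1$. 2. Let the step size be $\eta=\eta_0$ or, more generally, any $\eta\in(0,1/M)$ with $F(\eta)<1$, and put $c_0=\dfrac{\eta\sigma^\alpha}{1-F(\eta)}$. If the law of $X_0$ satisfies an $\alpha$-stable Poincaré inequality with constants $(\gamma,0)$, where $0\le\gamma\le c_0$, then for every $k\in\mathbb N$ the law of $X_k$ satisfies an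 $\alpha$-stable Poincaré inequality with constants $(c_0,0)$. -/

import Mathlib

open MeasureTheory ProbabilityTheory
open scoped ENNReal NNReal

noncomputable section

/-- The normalising constant `C_{α,d}` of the Lévy measure `C_{α,d} ‖z‖^{-(d+α)} dz` of the
rotationally invariant `α`-stable process with characteristic exponent `‖ξ‖^α`. -/
def stableConst (α : ℝ) (d : ℕ) : ℝ :=
  α * (2 : ℝ) ^ (α - 1) * Real.pi ^ (-(d : ℝ) / 2) *
    (Real.Gamma ((α + d) / 2) / Real.Gamma (1 - α / 2))

/-- `μ` satisfies an `α`-stable Poincaré inequality with constants `(a, b)` (with `a, b ≥ 0`):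
for every differentiable `μ`-square-integrable `f`,
`∫ f² dμ - (∫ f dμ)² ≤ a C_{α,d} ∫_{z ≠ 0} ∫ (f x - f (x+z))² / ‖z‖^{d+α} dμ(x) dz + b ∫ ‖∇f‖² dμ`.
The two energies on the right may be infinite, so they are `ℝ≥0∞`-valued integrals. -/
def StablePoincare {d : ℕ} (α : ℝ) (μ : Measure (EuclideanSpace ℝ (Fin d))) (a b : ℝ) : Prop :=
  ∀ f : EuclideanSpace ℝ (Fin d) → ℝ, Differentiable ℝ f → MemLp f 2 μ →
    ENNReal.ofReal (∫ x, f x ^ 2 ∂μ - (∫ x, f x ∂μ) ^ 2) ≤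
      ENNReal.ofReal (a * stableConst α d) *
          (∫⁻ z in {0}ᶜ, ∫⁻ x, ENNReal.ofReal ((f x - f (x + z)) ^ 2 / ‖z‖ ^ ((d : ℝ) + α)) ∂μ) +
        ENNReal.ofReal b * ∫⁻ x, ENNReal.ofReal (‖gradient f x‖ ^ 2) ∂μ

/-- `μ` is the law of `L_1^α`, the standard rotationally invariant `α`-stable law on `ℝ^d`, that is,
the law with characteristic function `t ↦ exp (-‖t‖^α)`. -/
def IsStandardStable {d : ℕ} (α : ℝ) (μ : Measure (EuclideanSpace ℝ (Fin d))) : Prop :=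
  ∀ t : EuclideanSpace ℝ (Fin d), charFun μ t = Complex.exp (-((‖t‖ ^ α : ℝ) : ℂ))

/-- `f` is `M`-smooth: differentiable with `M`-Lipschitz gradient. -/
def IsSmoothWith {d : ℕ} (M : ℝ) (f : EuclideanSpace ℝ (Fin d) → ℝ) : Prop :=
  Differentiable ℝ f ∧ ∀ x y, ‖gradient f x - gradient f y‖ ≤ M * ‖x - y‖

/-- The gradient at `x` of the average loss over the data `S i`, `i ∈ B`
(for `B = Finset.univ`, the gradient of the empirical risk). -/
def batchGradient {d n : ℕ} {Z : Type*} (ℓ : EuclideanSpace ℝ (Fin d) → Z → ℝ) (S : Fin n → Z)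
    (B : Finset (Fin n)) (x : EuclideanSpace ℝ (Fin d)) : EuclideanSpace ℝ (Fin d) :=
  (B.card : ℝ)⁻¹ • ∑ i ∈ B, gradient (fun w => ℓ w (S i)) x

/-- `X` is heavy-tailed gradient descent without projection, with step size `η`, noise level `σ`,
batches `B k` and noise `ξ`:
`X (k+1) = X k - η ĝ_S(X k, B k) + σ η^{1/α} ξ k`, where the `ξ k` are i.i.d. standard
`α`-stable vectors, independent of `X 0`. -/
structure IsHeavyTailedGD {Ω : Type*} [MeasurableSpace Ω] (P : Measure Ω) {d n : ℕ} {Z : Type*}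
    (ℓ : EuclideanSpace ℝ (Fin d) → Z → ℝ) (S : Fin n → Z) (B : ℕ → Finset (Fin n))
    (α σ η : ℝ) (X ξ : ℕ → Ω → EuclideanSpace ℝ (Fin d)) : Prop where
  measurable_init : Measurable (X 0)
  measurable_noise : ∀ k, Measurable (ξ k)
  noise_law : ∀ k, IsStandardStable α (P.map (ξ k))
  noise_indep : iIndepFun ξ P
  init_indep : IndepFun (X 0) (fun ω k => ξ k ω) P
  step : ∀ k ω, X (k + 1) ω =
    X k ω - η • batchGradient ℓ S (B k) (X k ω) + (σ * η ^ (1 / α)) • ξ k ω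

/-- `F(η) = (1 - ηλ)^{α+d} / (1 - ηM)^d`. If `λ = M`, then at `η = 1/M` this quotient is `0 / 0`,
which Lean evaluates to `0`; this is also the limit of `F` at `1/M`. -/
def contractionFactor (d : ℕ) (α lam M η : ℝ) : ℝ :=
  (1 - η * lam) ^ (α + d) / (1 - η * M) ^ d

/-- `η₀ = ((α + d)λ - dM) / (αλM)`, the critical point of `F`. -/
def criticalStep (d : ℕ) (α lam M : ℝ) : ℝ :=
  ((α + d) * lam - d * M) / (α * lam * M)

/-- `c₀ = ησ^α / (1 - F(η))`. -/
def poincareConst (d : ℕ) (α σ lam M η : ℝ) : ℝ :=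
  η * σ ^ α / (1 - contractionFactor d α lam M η)

end

noncomputable section

open Filter Topology

/-! One step of the recursion turns the law `μ` of `X k` into `(μ.map G) ∗ p`, where `G x = x - η •
batchGradient ℓ S (B k) x` and `p` is the stable law with characteristic function `exp (-ησ^α
‖t‖^α)`. By cocoercivity and the reverse triangle inequality, `G` multiplies distances by a factor
between `1 - ηM` and `1 - ηλ`. The substitution `w = G (x + z) - G x` in the non-local energy then
costs `(1 - ηλ)^(α + d)` from the kernel and `(1 - ηM)^(-d)` from the volume, so the pushforward
multiplies the constant by `F(η)` (`LipPoincare.map`). Under convolution constants add, by the law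
of total variance and Jensen (`LipPoincare.conv`), and `p` has constant `ησ^α`
(`IsStableLaw.lipPoincare`). The constant thus evolves by `c ↦ F(η) c + ησ^α`, whose fixed point is
`c₀`. The bound `F(η₀) < 1` is Bernoulli's inequality.

The class of test functions is the delicate point. The map `G` is only Lipschitz, so `f ∘ G` need
not be differentiable. The contraction argument therefore uses bounded Lipschitz functions, a class
stable under composition with `G` and under averaging. Mollification leads from differentiable
functions to this class. For the way back, a square-integrable `f` is clipped, and a small part of
the stable noise is split off to make it Lipschitz (`LipPoincare.conv_stable_of_continuous`).

The inequality for `p` comes from sums of `n + 1` independent jumps, each a Gaussian vector run for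
an independent Pareto time (subordination). The jump law times `n + 1` is dominated by the Lévy
measure, so Efron–Stein yields the inequality before the limit. The same representation bounds the
mean inverse square root of the total time uniformly in `n`, which gives the Lipschitz smoothing by
`p`. -/

/-- The Euclidean space `ℝ^d`. -/
abbrev Euc (d : ℕ) := EuclideanSpace ℝ (Fin d)

/-- The non-local energy in the `α`-stable Poincaré inequality. -/
def levyEnergy {d : ℕ} (α : ℝ) (μ : Measure (Euc d)) (f : Euc d → ℝ) : ℝ≥0∞ :=
  ∫⁻ z in {0}ᶜ, ∫⁻ x, ENNReal.ofReal ((f x - f (x + z)) ^ 2 / ‖z‖ ^ ((d : ℝ) + α)) ∂μ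

/-- The variance `∫ f² dμ - (∫ f dμ)²`. -/
def varOf {d : ℕ} (μ : Measure (Euc d)) (f : Euc d → ℝ) : ℝ :=
  ∫ x, f x ^ 2 ∂μ - (∫ x, f x ∂μ) ^ 2

/-- The average of the translates of `f` over `ν`. -/
def meanShift {d : ℕ} (ν : Measure (Euc d)) (f : Euc d → ℝ) (x : Euc d) : ℝ :=
  ∫ y, f (x + y) ∂ν

/-- The `α`-stable Poincaré inequality with constants `(a, 0)` for bounded Lipschitz functions. -/
def LipPoincare {d : ℕ} (α : ℝ) (μ : Measure (Euc d)) (a : ℝ) : Prop :=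
  ∀ (f : Euc d → ℝ) (N : ℝ) (K : ℝ≥0), (∀ x, |f x| ≤ N) → LipschitzWith K f →
    ENNReal.ofReal (varOf μ f) ≤ ENNReal.ofReal (a * stableConst α d) * levyEnergy α μ f

/-! ### Variance and non-local energy under convolution. -/

section Basic

variable {d : ℕ} {α : ℝ} {μ ν : Measure (Euc d)} {f : Euc d → ℝ} {N : ℝ}

lemma integrable_of_abs_le [IsFiniteMeasure μ] (hf : Measurable f) (hN : ∀ x, |f x| ≤ N) :
    Integrable f μ :=
  Integrable.of_bound hf.aestronglyMeasurable N (.of_forall hN)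

lemma abs_sq_le_sq {a N : ℝ} (h : |a| ≤ N) : |a ^ 2| ≤ N ^ 2 := by
  rw [abs_pow]; gcongr

lemma measurable_meanShift [SFinite ν] (hf : Measurable f) : Measurable (meanShift ν f) := by
  have : StronglyMeasurable (Function.uncurry fun x y : Euc d => f (x + y)) :=
    (hf.comp measurable_add).stronglyMeasurable
  exact this.integral_prod_right.measurable

lemma abs_meanShift_le [IsProbabilityMeasure ν] (hN : ∀ x, |f x| ≤ N) (x : Euc d) :
    |meanShift ν f x| ≤ N := by
  have := norm_integral_le_of_norm_le_const (μ := ν) (f := fun y => f (x + y)) (C := N)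
    (.of_forall fun y => hN _)
  simpa [meanShift] using this

lemma LipschitzWith.meanShift [IsProbabilityMeasure ν] {K : ℝ≥0} (hf : LipschitzWith K f)
    (hN : ∀ x, |f x| ≤ N) : LipschitzWith K (meanShift ν f) := by
  refine LipschitzWith.of_dist_le_mul fun x y => ?_
  have hm : Measurable f := hf.continuous.measurable
  have hi : ∀ x, Integrable (fun y => f (x + y)) ν := fun x =>
    integrable_of_abs_le (hm.comp (measurable_const_add x)) (fun y => hN _)
  rw [Real.dist_eq, _root_.meanShift, _root_.meanShift, ← integral_sub (hi x) (hi y)]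
  have := norm_integral_le_of_norm_le_const (μ := ν) (f := fun z => f (x + z) - f (y + z))
    (C := K * dist x y) (.of_forall fun z => by
      have := hf.dist_le_mul (x + z) (y + z)
      rwa [dist_add_right, Real.dist_eq] at this)
  simpa using this

lemma varOf_nonneg [IsProbabilityMeasure μ] (hf : Measurable f) (hN : ∀ x, |f x| ≤ N) :
    0 ≤ varOf μ f := by
  have h2 : MemLp f 2 μ := MemLp.of_bound hf.aestronglyMeasurable N (.of_forall hN)
  have := variance_eq_sub h2
  have h0 := variance_nonneg f μ
  simp only [Pi.pow_apply] at this
  rw [varOf, ← this]; exact h0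

lemma integral_conv_of_abs_le [IsProbabilityMeasure μ] [IsProbabilityMeasure ν]
    (hf : Measurable f) (hN : ∀ x, |f x| ≤ N) :
    ∫ x, f x ∂(μ ∗ ν) = ∫ x, meanShift ν f x ∂μ :=
  integral_conv (integrable_of_abs_le hf hN)

/-- The law of total variance for a sum of two independent variables, conditioning on the first. -/
lemma varOf_conv [IsProbabilityMeasure μ] [IsProbabilityMeasure ν]
    (hf : Measurable f) (hN : ∀ x, |f x| ≤ N) :
    varOf (μ ∗ ν) f =
      ∫ x, varOf ν (fun y => f (x + y)) ∂μ + varOf μ (meanShift ν f) := by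
  have h2 : Measurable fun x => f x ^ 2 := hf.pow_const 2
  have hN2 : ∀ x, |f x ^ 2| ≤ N ^ 2 := fun x => abs_sq_le_sq (hN x)
  have e : ∀ x, varOf ν (fun y => f (x + y)) =
      meanShift ν (fun x => f x ^ 2) x - meanShift ν f x ^ 2 := fun x => rfl
  simp_rw [e]
  rw [integral_sub (integrable_of_abs_le (measurable_meanShift h2) (abs_meanShift_le hN2))
    (integrable_of_abs_le ((measurable_meanShift hf).pow_const 2)
      fun x => abs_sq_le_sq (abs_meanShift_le hN x)),
    varOf, varOf, integral_conv_of_abs_le hf hN, integral_conv_of_abs_le h2 hN2]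
  ring

lemma ofReal_varOf_conv_le [IsProbabilityMeasure μ] [IsProbabilityMeasure ν]
    (hf : Measurable f) (hN : ∀ x, |f x| ≤ N) {g : Euc d → ℝ≥0∞}
    (hg : ∀ x, ENNReal.ofReal (varOf ν fun y => f (x + y)) ≤ g x) :
    ENNReal.ofReal (varOf (μ ∗ ν) f) ≤
      ∫⁻ x, g x ∂μ + ENNReal.ofReal (varOf μ (meanShift ν f)) := by
  have h2 : Measurable fun x => f x ^ 2 := hf.pow_const 2
  have hN2 : ∀ x, |f x ^ 2| ≤ N ^ 2 := fun x => abs_sq_le_sq (hN x)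
  rw [varOf_conv hf hN]
  refine ENNReal.ofReal_add_le.trans (add_le_add_left ?_ _)
  have hi : Integrable (fun x => varOf ν (fun y => f (x + y))) μ :=
    (integrable_of_abs_le (measurable_meanShift h2) (abs_meanShift_le hN2)).sub
      (integrable_of_abs_le ((measurable_meanShift hf).pow_const 2)
      fun x => abs_sq_le_sq (abs_meanShift_le hN x))
  rw [ofReal_integral_eq_lintegral_ofReal hi (.of_forall fun x =>
    varOf_nonneg (hf.comp (measurable_const_add x)) fun y => hN _)]
  exact lintegral_mono hg

/-- Jensen's inequality, read off from the nonnegative variance of `y ↦ f (x + y) - f (x + y + z)`.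
-/
lemma sq_meanShift_sub_le [IsProbabilityMeasure ν] (hf : Measurable f) (hN : ∀ x, |f x| ≤ N)
    (x z : Euc d) :
    (meanShift ν f x - meanShift ν f (x + z)) ^ 2 ≤
      meanShift ν (fun x => (f x - f (x + z)) ^ 2) x := by
  have hm : Measurable fun x => f x - f (x + z) := hf.sub (hf.comp (measurable_add_const z))
  have hb : ∀ x, |f x - f (x + z)| ≤ N + N := fun x =>
    (abs_sub _ _).trans (add_le_add (hN _) (hN _))
  have h := varOf_nonneg (μ := ν) (hm.comp (measurable_const_add x)) fun y => hb _
  have hi : ∀ x, Integrable (fun y => f (x + y)) ν := fun x =>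
    integrable_of_abs_le (hf.comp (measurable_const_add x)) (fun y => hN _)
  have e : meanShift ν f x - meanShift ν f (x + z) = ∫ y, (f (x + y) - f (x + y + z)) ∂ν := by
    rw [meanShift, meanShift, ← integral_sub (hi _) (hi _)]
    simp_rw [add_right_comm]
  rw [e]
  simp only [varOf, Function.comp] at h
  simp only [meanShift]
  linarith

lemma lintegral_sq_meanShift_sub_le [IsProbabilityMeasure μ] [IsProbabilityMeasure ν]
    (hf : Measurable f) (hN : ∀ x, |f x| ≤ N) (z : Euc d) :
    ∫⁻ x, ENNReal.ofReal ((meanShift ν f x - meanShift ν f (x + z)) ^ 2) ∂μ ≤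
      ∫⁻ x, ENNReal.ofReal ((f x - f (x + z)) ^ 2) ∂(μ ∗ ν) := by
  have hm : Measurable fun x => (f x - f (x + z)) ^ 2 :=
    (hf.sub (hf.comp (measurable_add_const z))).pow_const 2
  have hb : ∀ x, |(f x - f (x + z)) ^ 2| ≤ (N + N) ^ 2 := fun x =>
    abs_sq_le_sq ((abs_sub _ _).trans (add_le_add (hN _) (hN _)))
  rw [Measure.lintegral_conv hm.ennreal_ofReal]
  refine lintegral_mono fun x => ?_
  refine (ENNReal.ofReal_le_ofReal (sq_meanShift_sub_le hf hN x z)).trans_eq ?_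
  rw [meanShift, ofReal_integral_eq_lintegral_ofReal]
  · exact integrable_of_abs_le (hm.comp (measurable_const_add x)) fun y => hb _
  · exact .of_forall fun y => sq_nonneg _

/-- The weight `‖z‖ ^ (-(d + α))`, as an extended nonnegative number. -/
def levyWeight (d : ℕ) (α : ℝ) (z : Euc d) : ℝ≥0∞ := ENNReal.ofReal ((‖z‖ ^ ((d : ℝ) + α))⁻¹)

lemma measurable_levyWeight : Measurable (levyWeight d α) := by
  unfold levyWeight; fun_prop

lemma levyEnergy_eq (hf : Measurable f) : levyEnergy α μ f =
    ∫⁻ z in {0}ᶜ, levyWeight d α z * ∫⁻ x, ENNReal.ofReal ((f x - f (x + z)) ^ 2) ∂μ := by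
  refine lintegral_congr fun z => ?_
  have hm : Measurable fun x => ENNReal.ofReal ((f x - f (x + z)) ^ 2) :=
    ((hf.sub (hf.comp (measurable_add_const z))).pow_const 2).ennreal_ofReal
  rw [← lintegral_const_mul _ hm]
  refine lintegral_congr fun x => ?_
  rw [levyWeight, ← ENNReal.ofReal_mul (by positivity), div_eq_inv_mul]

lemma levyEnergy_meanShift_le [IsProbabilityMeasure μ] [IsProbabilityMeasure ν]
    (hf : Measurable f) (hN : ∀ x, |f x| ≤ N) :
    levyEnergy α μ (meanShift ν f) ≤ levyEnergy α (μ ∗ ν) f := by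
  rw [levyEnergy_eq hf, levyEnergy_eq (measurable_meanShift hf)]
  exact lintegral_mono fun z => mul_le_mul_right (lintegral_sq_meanShift_sub_le hf hN z) _

lemma measurable_incr (hf : Measurable f) : Measurable
    (fun p : Euc d × Euc d => ENNReal.ofReal ((f p.1 - f (p.1 + p.2)) ^ 2 /
      ‖p.2‖ ^ ((d : ℝ) + α))) := by
  have h1 : Measurable fun p : Euc d × Euc d => f p.1 := hf.comp measurable_fst
  have h2 : Measurable fun p : Euc d × Euc d => f (p.1 + p.2) :=
    hf.comp (measurable_fst.add measurable_snd)
  fun_prop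

lemma levyEnergy_swap [SFinite μ] (hf : Measurable f) : levyEnergy α μ f =
    ∫⁻ x, (∫⁻ z in {0}ᶜ,
      ENNReal.ofReal ((f x - f (x + z)) ^ 2 / ‖z‖ ^ ((d : ℝ) + α))) ∂μ := by
  exact lintegral_lintegral_swap (f := fun z x =>
    ENNReal.ofReal ((f x - f (x + z)) ^ 2 / ‖z‖ ^ ((d : ℝ) + α)))
    ((measurable_incr hf).comp measurable_swap).aemeasurable

/-- The kernel depends on the increment `z` alone, so the first summand only translates `f`. -/
lemma levyEnergy_conv [IsProbabilityMeasure μ] [IsProbabilityMeasure ν] (hf : Measurable f) :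
    levyEnergy α (μ ∗ ν) f = ∫⁻ x, levyEnergy α ν (fun y => f (x + y)) ∂μ := by
  have hm : Measurable fun x => ∫⁻ z in {0}ᶜ,
      ENNReal.ofReal ((f x - f (x + z)) ^ 2 / ‖z‖ ^ ((d : ℝ) + α)) :=
    (measurable_incr hf).lintegral_prod_right'
  rw [levyEnergy_swap hf]
  refine (Measure.lintegral_conv (μ := μ) (ν := ν) hm).trans (lintegral_congr fun x => ?_)
  refine Eq.trans ?_ (levyEnergy_swap (hf.comp (measurable_const_add x))).symm
  simp only [add_assoc, Function.comp]

/-- In the law of total variance, the inequality of `ν` controls the conditional variance, whose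
energies integrate exactly to the energy of `μ ∗ ν`. The inequality of `μ` controls the variance of
the conditional mean, whose energy is at most the same quantity by Jensen. -/
lemma LipPoincare.conv [IsProbabilityMeasure μ] [IsProbabilityMeasure ν] {a b : ℝ}
    (ha : 0 ≤ a) (hb : 0 ≤ b) (hC : 0 ≤ stableConst α d)
    (hμ : LipPoincare α μ a) (hν : LipPoincare α ν b) : LipPoincare α (μ ∗ ν) (a + b) := by
  intro f N K hN hf
  have hm : Measurable f := hf.continuous.measurable
  refine (ofReal_varOf_conv_le hm hN (g := fun x => ENNReal.ofReal (b * stableConst α d) *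
    levyEnergy α ν fun y => f (x + y)) fun x => ?_).trans ?_
  · refine hν _ N K (fun y => hN _) ?_
    simpa [Function.comp_def] using hf.comp (isometry_add_left x).lipschitz
  · rw [lintegral_const_mul' _ _ ENNReal.ofReal_ne_top, ← levyEnergy_conv hm, add_mul,
      ENNReal.ofReal_add (mul_nonneg ha hC) (mul_nonneg hb hC), add_mul, add_comm]
    gcongr
    refine (hμ _ N K (abs_meanShift_le hN) (hf.meanShift hN)).trans ?_
    gcongr
    exact levyEnergy_meanShift_le hm hN

end Basic

/-! ### Bounded Lipschitz test functions: finite energy and mollification. -/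

section LipEnergy

variable {d : ℕ} {α : ℝ} {μ ν : Measure (Euc d)} {f : Euc d → ℝ} {N : ℝ}

/-- In polar coordinates the integrand is at most a multiple of `r ^ (1 - α)` near `0` and of `r ^
(-1 - α)` at infinity, hence the need for `0 < α < 2`. This is the dominating function for all
limits of energies. -/
lemma lintegral_levyWeight_mul_min_ne_top (hd : 0 < d) (h0 : 0 < α) (h2 : α < 2) {A B : ℝ}
    (hA : 0 ≤ A) (hB : 0 ≤ B) :
    ∫⁻ z in ({0}ᶜ : Set (Euc d)), levyWeight d α z * ENNReal.ofReal (min A (B * ‖z‖ ^ 2)) ≠ ∞ := by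
  have hn : Nontrivial (Euc d) := by
    have : Nonempty (Fin d) := ⟨⟨0, hd⟩⟩
    infer_instance
  let φ : ℝ → ℝ := fun r => (r ^ ((d : ℝ) + α))⁻¹ * min A (B * r ^ 2)
  have hφ : Integrable (fun z : Euc d => φ ‖z‖) := by
    rw [integrable_fun_norm_addHaar volume (f := φ)]
    have hm : Measurable fun y : ℝ => y ^ (Module.finrank ℝ (Euc d) - 1) • φ y := by
      unfold φ; fun_prop
    rw [finrank_euclideanSpace_fin] at hm ⊢
    have e : ∀ y : ℝ, 0 < y → ∀ c : ℝ,
        y ^ (d - 1) • ((y ^ ((d : ℝ) + α))⁻¹ * c) = y ^ (-1 - α) * c := by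
      intro y hy c
      rw [smul_eq_mul, ← mul_assoc, ← Real.rpow_neg hy.le, ← Real.rpow_natCast,
        ← Real.rpow_add hy]
      congr 2
      rw [Nat.cast_sub hd]; push_cast; ring
    rw [← Set.Ioc_union_Ioi_eq_Ioi zero_le_one]
    refine IntegrableOn.union ?_ ?_
    · have hi : IntegrableOn (fun y : ℝ => B * y ^ (1 - α)) (Set.Ioc 0 1) := by
        refine Integrable.const_mul ?_ _
        have := (intervalIntegral.intervalIntegrable_rpow' (a := 0) (b := 1) (r := 1 - α)
          (by linarith))
        rwa [intervalIntegrable_iff_integrableOn_Ioc_of_le zero_le_one] at this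
      refine Integrable.mono' hi hm.aestronglyMeasurable ?_
      refine (ae_restrict_iff' measurableSet_Ioc).2 (.of_forall fun y hy => ?_)
      rw [e y hy.1, Real.norm_of_nonneg (mul_nonneg (Real.rpow_nonneg hy.1.le _)
        (le_min hA (by positivity)))]
      calc y ^ (-1 - α) * min A (B * y ^ 2) ≤ y ^ (-1 - α) * (B * y ^ 2) := by
            gcongr
            · exact Real.rpow_nonneg hy.1.le _
            · exact min_le_right _ _
        _ = B * (y ^ (-1 - α) * y ^ (2 : ℝ)) := by rw [Real.rpow_two]; ring
        _ = B * y ^ (1 - α) := by rw [← Real.rpow_add hy.1]; ring_nf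
    · have hi : IntegrableOn (fun y : ℝ => y ^ (-1 - α) * A) (Set.Ioi 1) :=
        Integrable.mul_const (integrableOn_Ioi_rpow_of_lt (by linarith) zero_lt_one) _
      refine Integrable.mono' hi hm.aestronglyMeasurable ?_
      refine (ae_restrict_iff' measurableSet_Ioi).2 (.of_forall fun y hy => ?_)
      have hy0 : 0 < y := zero_lt_one.trans hy
      rw [e y hy0, Real.norm_of_nonneg (mul_nonneg (Real.rpow_nonneg hy0.le _)
        (le_min hA (by positivity)))]
      gcongr
      · exact min_le_left _ _
  refine ne_top_of_le_ne_top hφ.lintegral_lt_top.ne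
    ((lintegral_mono fun z => ?_).trans (setLIntegral_le_lintegral _ _))
  rw [levyWeight, ← ENNReal.ofReal_mul (by positivity)]

lemma sq_sub_le_min {K : ℝ≥0} (hf : LipschitzWith K f) (hN : ∀ x, |f x| ≤ N) (x z : Euc d) :
    (f x - f (x + z)) ^ 2 ≤ min ((2 * N) ^ 2) ((K : ℝ) ^ 2 * ‖z‖ ^ 2) := by
  have h1 : |f x - f (x + z)| ≤ 2 * N :=
    (abs_sub _ _).trans ((add_le_add (hN _) (hN _)).trans_eq (by ring))
  have h2 : |f x - f (x + z)| ≤ K * ‖z‖ := by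
    have := hf.dist_le_mul x (x + z)
    simpa [Real.dist_eq] using this
  rw [← mul_pow]
  exact le_min (sq_le_sq.2 (h1.trans (le_abs_self _))) (sq_le_sq.2 (h2.trans (le_abs_self _)))

lemma tendsto_lintegral_levyWeight_mul (hd : 0 < d) (h0 : 0 < α) (h2 : α < 2) {A B : ℝ}
    (hA : 0 ≤ A) (hB : 0 ≤ B) {h : ℕ → Euc d → ℝ≥0∞} {g : Euc d → ℝ≥0∞}
    (hm : ∀ n, Measurable (h n)) (hle : ∀ n z, h n z ≤ ENNReal.ofReal (min A (B * ‖z‖ ^ 2)))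
    (hlim : ∀ z, Tendsto (fun n => h n z) atTop (𝓝 (g z))) :
    Tendsto (fun n => ∫⁻ z in {0}ᶜ, levyWeight d α z * h n z) atTop
      (𝓝 (∫⁻ z in {0}ᶜ, levyWeight d α z * g z)) := by
  refine tendsto_lintegral_of_dominated_convergence
    (fun z => levyWeight d α z * ENNReal.ofReal (min A (B * ‖z‖ ^ 2)))
    (fun n => measurable_levyWeight.mul (hm n)) (fun n => .of_forall fun z => ?_)
    (lintegral_levyWeight_mul_min_ne_top hd h0 h2 hA hB) (.of_forall fun z => ?_)
  · exact mul_le_mul_right (hle n z) _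
  · exact ENNReal.Tendsto.const_mul (hlim z) (.inr ENNReal.ofReal_ne_top)

lemma measurable_lintegral_sq_sub [SFinite μ] (hf : Measurable f) :
    Measurable fun z => ∫⁻ x, ENNReal.ofReal ((f x - f (x + z)) ^ 2) ∂μ := by
  have h1 : Measurable fun p : Euc d × Euc d => f p.2 := hf.comp measurable_snd
  have h2 : Measurable fun p : Euc d × Euc d => f (p.2 + p.1) :=
    hf.comp (measurable_snd.add measurable_fst)
  have : Measurable fun p : Euc d × Euc d => ENNReal.ofReal ((f p.2 - f (p.2 + p.1)) ^ 2) := by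
    fun_prop
  exact this.lintegral_prod_right'

lemma lintegral_sq_sub_le [IsProbabilityMeasure μ] {K : ℝ≥0} (hf : LipschitzWith K f)
    (hN : ∀ x, |f x| ≤ N) (z : Euc d) : ∫⁻ x, ENNReal.ofReal ((f x - f (x + z)) ^ 2) ∂μ ≤
      ENNReal.ofReal (min ((2 * N) ^ 2) ((K : ℝ) ^ 2 * ‖z‖ ^ 2)) := by
  refine (lintegral_mono fun x => ENNReal.ofReal_le_ofReal (sq_sub_le_min hf hN x z)).trans ?_
  simp

/-- Convergence of the energies of uniformly bounded, uniformly Lipschitz functions. -/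
lemma tendsto_levyEnergy (hd : 0 < d) (h0 : 0 < α) (h2 : α < 2) {μs : ℕ → Measure (Euc d)}
    {fs : ℕ → Euc d → ℝ} {K : ℝ≥0} [∀ n, IsProbabilityMeasure (μs n)]
    (hfs : ∀ n, LipschitzWith K (fs n)) (hNs : ∀ n x, |fs n x| ≤ N)
    (hf : Measurable f)
    (hlim : ∀ z, Tendsto (fun n => ∫⁻ x, ENNReal.ofReal ((fs n x - fs n (x + z)) ^ 2) ∂(μs n)) atTop
      (𝓝 (∫⁻ x, ENNReal.ofReal ((f x - f (x + z)) ^ 2) ∂μ))) :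
    Tendsto (fun n => levyEnergy α (μs n) (fs n)) atTop (𝓝 (levyEnergy α μ f)) := by
  rw [levyEnergy_eq hf]
  simp_rw [fun n => levyEnergy_eq (α := α) (μ := μs n) (hfs n).continuous.measurable]
  exact tendsto_lintegral_levyWeight_mul hd h0 h2 (sq_nonneg _) (sq_nonneg _)
    (fun n => measurable_lintegral_sq_sub (hfs n).continuous.measurable)
    (fun n z => lintegral_sq_sub_le (hfs n) (hNs n) z) hlim

/-- Mollification by a smooth bump, written as an average over a probability measure so that the sup
bound and the Lipschitz constant carry over unchanged. -/
lemma exists_differentiable_approx {K : ℝ≥0} (hf : LipschitzWith K f) (hN : ∀ x, |f x| ≤ N)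
    {ε : ℝ} (hε : 0 < ε) : ∃ g : Euc d → ℝ, Differentiable ℝ g ∧ (∀ x, |g x| ≤ N) ∧
      LipschitzWith K g ∧ ∀ x, |g x - f x| ≤ ε := by
  -- On a ball of radius `r` the function varies by at most `K * r ≤ ε`; the `+ 1` allows `K = 0`.
  set r : ℝ := ε / (K + 1) with hr
  have hr0 : 0 < r := by positivity
  let φ : ContDiffBump (0 : Euc d) := ⟨r / 2, r, by positivity, by linarith⟩
  let w : Euc d → ℝ := φ.normed volume
  have hw0 : ∀ x, 0 ≤ w x := φ.nonneg_normed
  have hwc : Continuous w := φ.continuous_normed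
  have hwi : Integrable w := φ.integrable_normed
  -- The bump is reflected because `meanShift` evaluates `f` at `x + y`, the convolution at `x - y`.
  let ρ : Euc d → ℝ≥0 := fun t => ⟨w (-t), hw0 _⟩
  have hρ : Measurable ρ := (hwc.comp continuous_neg).measurable.subtype_mk
  let ν : Measure (Euc d) := volume.withDensity fun t => (ρ t : ℝ≥0∞)
  have hν : IsProbabilityMeasure ν := by
    refine ⟨?_⟩
    have e : ∀ t, (ρ t : ℝ≥0∞) = ENNReal.ofReal (w (-t)) := fun t => by
      rw [ENNReal.ofReal, Real.toNNReal_of_nonneg (hw0 _)]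
      rfl
    rw [withDensity_apply _ .univ, setLIntegral_univ]
    simp_rw [e]
    rw [← ofReal_integral_eq_lintegral_ofReal hwi.comp_neg (.of_forall fun _ => hw0 _),
      integral_neg_eq_self, φ.integral_normed, ENNReal.ofReal_one]
  have e : ∀ x, meanShift ν f x = convolution w f (ContinuousLinearMap.lsmul ℝ ℝ) volume x := by
    intro x
    rw [meanShift, integral_withDensity_eq_integral_smul hρ, convolution_def,
      ← integral_neg_eq_self]
    refine integral_congr_ae (.of_forall fun t => ?_)
    simp only [ρ, neg_neg, sub_eq_add_neg]
    rfl
  refine ⟨meanShift ν f, ?_, abs_meanShift_le hN, hf.meanShift hN, fun x => ?_⟩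
  · rw [funext e]
    have : ContDiff ℝ 1 (convolution w f (ContinuousLinearMap.lsmul ℝ ℝ) volume) :=
      φ.hasCompactSupport_normed.contDiff_convolution_left (n := 1) _ φ.contDiff_normed
        hf.continuous.locallyIntegrable
    exact this.differentiable one_ne_zero
  · rw [e x]
    have := φ.dist_normed_convolution_le (μ := volume) (g := f) (x₀ := x) (ε := ε)
      hf.continuous.aestronglyMeasurable ?_
    · simpa [Real.dist_eq, w] using this
    · intro y hy
      have hy' : dist y x < r := hy
      calc dist (f y) (f x) ≤ K * dist y x := hf.dist_le_mul _ _
        _ ≤ (K + 1) * r := by gcongr; linarith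
        _ = ε := by rw [hr]; field_simp

lemma tendsto_integral_of_bounded {Ω : Type*} [MeasurableSpace Ω] {m : Measure Ω}
    [IsFiniteMeasure m] {F : ℕ → Ω → ℝ} {g : Ω → ℝ} (hF : ∀ n, Measurable (F n)) {C : ℝ}
    (hC : ∀ n x, |F n x| ≤ C) (hlim : ∀ x, Tendsto (fun n => F n x) atTop (𝓝 (g x))) :
    Tendsto (fun n => ∫ x, F n x ∂m) atTop (𝓝 (∫ x, g x ∂m)) :=
  tendsto_integral_of_dominated_convergence (fun _ => C) (fun n => (hF n).aestronglyMeasurable)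
    (integrable_const _) (fun n => .of_forall (hC n)) (.of_forall hlim)

lemma tendsto_lintegral_of_bounded {Ω : Type*} [MeasurableSpace Ω] {m : Measure Ω}
    [IsFiniteMeasure m] {F : ℕ → Ω → ℝ} {g : Ω → ℝ} (hF : ∀ n, Measurable (F n)) {C : ℝ}
    (hC : ∀ n x, |F n x| ≤ C) (hlim : ∀ x, Tendsto (fun n => F n x) atTop (𝓝 (g x))) :
    Tendsto (fun n => ∫⁻ x, ENNReal.ofReal (F n x) ∂m) atTop
      (𝓝 (∫⁻ x, ENNReal.ofReal (g x) ∂m)) := by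
  refine tendsto_lintegral_of_dominated_convergence (fun _ => ENNReal.ofReal C)
    (fun n => (hF n).ennreal_ofReal)
    (fun n => .of_forall fun x => ENNReal.ofReal_le_ofReal ((le_abs_self _).trans (hC n x))) ?_
    (.of_forall fun x => (ENNReal.continuous_ofReal.tendsto _).comp (hlim x))
  simpa using ENNReal.mul_ne_top ENNReal.ofReal_ne_top (measure_ne_top m _)

lemma tendsto_varOf_of_bounded [IsProbabilityMeasure μ] {F : ℕ → Euc d → ℝ}
    (hF : ∀ n, Measurable (F n)) (hN : ∀ n x, |F n x| ≤ N)
    (hlim : ∀ x, Tendsto (fun n => F n x) atTop (𝓝 (f x))) :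
    Tendsto (fun n => varOf μ (F n)) atTop (𝓝 (varOf μ f)) :=
  (tendsto_integral_of_bounded (fun n => (hF n).pow_const 2)
    (fun n x => abs_sq_le_sq (hN n x)) fun x => (hlim x).pow 2).sub
    ((tendsto_integral_of_bounded hF hN hlim).pow 2)

/-- The mollified functions share one bound and one Lipschitz constant, so their variances and their
energies both converge. -/
lemma StablePoincare.lipPoincare [IsProbabilityMeasure μ] (hd : 0 < d) (h0 : 0 < α) (h2 : α < 2)
    {a : ℝ} (hμ : StablePoincare α μ a 0) : LipPoincare α μ a := by
  intro f N K hN hf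
  choose g hgd hgN hgK hgε using fun n : ℕ =>
    exists_differentiable_approx hf hN (ε := 1 / ((n : ℝ) + 1)) (by positivity)
  have hlim : ∀ x, Tendsto (fun n => g n x) atTop (𝓝 (f x)) := fun x => by
    rw [tendsto_iff_dist_tendsto_zero]
    exact squeeze_zero (fun n => dist_nonneg) (fun n => hgε n x)
      tendsto_one_div_add_atTop_nhds_zero_nat
  have hgm : ∀ n, Measurable (g n) := fun n => (hgK n).continuous.measurable
  have hE : Tendsto (fun n => levyEnergy α μ (g n)) atTop (𝓝 (levyEnergy α μ f)) := by
    refine tendsto_levyEnergy hd h0 h2 (μs := fun _ => μ) hgK hgN hf.continuous.measurable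
      fun z => ?_
    refine tendsto_lintegral_of_bounded (C := (2 * N) ^ 2) (fun n =>
      ((hgm n).sub ((hgm n).comp (measurable_add_const z))).pow_const 2) (fun n x => ?_)
      fun x => ((hlim x).sub (hlim (x + z))).pow 2
    rw [abs_of_nonneg (sq_nonneg _)]
    exact (sq_sub_le_min (hgK n) (hgN n) x z).trans (min_le_left _ _)
  refine le_of_tendsto_of_tendsto' ((ENNReal.continuous_ofReal.tendsto _).comp
    (tendsto_varOf_of_bounded hgm hgN hlim))
    (ENNReal.Tendsto.const_mul hE (.inr ENNReal.ofReal_ne_top)) fun n => ?_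
  have := hμ (g n) (hgd n) (MemLp.of_bound (hgm n).aestronglyMeasurable N (.of_forall (hgN n)))
  rw [ENNReal.ofReal_zero, zero_mul, add_zero] at this
  exact this

end LipEnergy

/-! ### Pushforward by a bi-Lipschitz map. -/

section Pushforward

variable {d : ℕ} {α : ℝ} {μ ν : Measure (Euc d)} {f : Euc d → ℝ} {N : ℝ}

/-- Lebesgue measure is a multiple of the `d`-dimensional Hausdorff measure, which scales under
antilipschitz maps. This replaces a Jacobian bound, since `G` need not be differentiable. -/
lemma volume_preimage_le_of_antilipschitz {K : ℝ≥0} {G : Euc d → Euc d}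
    (hG : AntilipschitzWith K G) (s : Set (Euc d)) :
    volume (G ⁻¹' s) ≤ (K : ℝ≥0∞) ^ d * volume s := by
  have e := Measure.isAddLeftInvariant_eq_smul (volume : Measure (Euc d))
    (Measure.hausdorffMeasure (d : ℝ))
  rw [e, Measure.smul_apply, Measure.smul_apply, ENNReal.smul_def, ENNReal.smul_def, smul_eq_mul,
    smul_eq_mul, mul_left_comm]
  have := hG.hausdorffMeasure_preimage_le (d := (d : ℝ)) (Nat.cast_nonneg d) s
  rw [ENNReal.rpow_natCast] at this
  gcongr

lemma lintegral_comp_le_of_antilipschitz {K : ℝ≥0} {G : Euc d → Euc d} (hGm : Measurable G)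
    (hG : AntilipschitzWith K G) {s : Set (Euc d)} (hs : MeasurableSet s) {H : Euc d → ℝ≥0∞}
    (hH : Measurable H) :
    ∫⁻ z in G ⁻¹' s, H (G z) ≤ (K : ℝ≥0∞) ^ d * ∫⁻ w in s, H w := by
  have hle : (volume.map G) ≤ (K : ℝ≥0∞) ^ d • (volume : Measure (Euc d)) := by
    refine Measure.le_iff.2 fun t ht => ?_
    rw [Measure.map_apply hGm ht]
    exact volume_preimage_le_of_antilipschitz hG t
  rw [← setLIntegral_map hs hH hGm]
  refine (lintegral_mono' (Measure.restrict_mono le_rfl hle) le_rfl).trans_eq ?_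
  rw [Measure.restrict_smul, lintegral_smul_measure, smul_eq_mul]

/-- Substitute `w z = G (x + z) - G x`. From `‖w z‖ ≤ q * ‖z‖` the kernel at `z` is at most `q ^ (α
+ d)` times the kernel at `w z`; since `w` is antilipschitz with constant `m⁻¹`, the change of
variables costs `m⁻¹ ^ d`. -/
lemma lintegral_incr_comp_le (hα : 0 < α) {G : Euc d → Euc d} {q m : ℝ}
    (hq : 0 ≤ q) (hm : 0 < m) (hGq : ∀ x y, ‖G x - G y‖ ≤ q * ‖x - y‖)
    (hGm : ∀ x y, m * ‖x - y‖ ≤ ‖G x - G y‖) (hG : Measurable G) (hf : Measurable f) (x : Euc d) :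
    ∫⁻ z in {0}ᶜ, ENNReal.ofReal ((f (G x) - f (G (x + z))) ^ 2 / ‖z‖ ^ ((d : ℝ) + α)) ≤
      ENNReal.ofReal (q ^ (α + d) / m ^ d) * ∫⁻ z in {0}ᶜ,
        ENNReal.ofReal ((f (G x) - f (G x + z)) ^ 2 / ‖z‖ ^ ((d : ℝ) + α)) := by
  obtain ⟨w, hwe⟩ : ∃ w : Euc d → Euc d, ∀ z, w z = G (x + z) - G x := ⟨_, fun _ => rfl⟩
  obtain ⟨H, hHe⟩ : ∃ H : Euc d → ℝ≥0∞, ∀ z,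
    H z = ENNReal.ofReal ((f (G x) - f (G x + z)) ^ 2 / ‖z‖ ^ ((d : ℝ) + α)) := ⟨_, fun _ => rfl⟩
  have hH : Measurable H := by
    have h1 : Measurable fun z => f (G x + z) := hf.comp (measurable_const_add _)
    rw [funext hHe]; fun_prop
  have hwm : Measurable w := by
    rw [funext hwe]; exact (hG.comp (measurable_const_add x)).sub_const _
  simp_rw [← hHe]
  obtain ⟨K, hK⟩ : ∃ K : ℝ≥0, (K : ℝ) = m⁻¹ := ⟨⟨m⁻¹, by positivity⟩, rfl⟩
  have hw : AntilipschitzWith K w := by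
    refine AntilipschitzWith.of_le_mul_dist fun y z => ?_
    have h := hGm (x + y) (x + z)
    rw [add_sub_add_left_eq_sub] at h
    rw [dist_eq_norm, dist_eq_norm, show w y - w z = G (x + y) - G (x + z) by
      simp [hwe], hK, inv_mul_eq_div, le_div_iff₀ hm]
    linarith
  have hw0 : ∀ z, z ≠ 0 → 0 < ‖w z‖ := by
    intro z hz
    have h := hGm (x + z) x
    rw [add_sub_cancel_left, ← hwe] at h
    exact lt_of_lt_of_le (mul_pos hm (norm_pos_iff.2 hz)) h
  have hpre : w ⁻¹' {0}ᶜ = {0}ᶜ := by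
    ext z
    simp only [Set.mem_preimage, Set.mem_compl_iff, Set.mem_singleton_iff]
    refine not_congr ⟨fun h => ?_, fun h => by simp [h, hwe]⟩
    by_contra hz
    exact (hw0 z hz).ne' (by rw [h, norm_zero])
  have key := lintegral_comp_le_of_antilipschitz hwm hw (measurableSet_singleton 0).compl hH
  rw [hpre] at key
  calc ∫⁻ z in {0}ᶜ, ENNReal.ofReal ((f (G x) - f (G (x + z))) ^ 2 / ‖z‖ ^ ((d : ℝ) + α))
      ≤ ∫⁻ z in {0}ᶜ, ENNReal.ofReal (q ^ (α + d)) * H (w z) := by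
        refine setLIntegral_mono' (measurableSet_singleton 0).compl fun z hz => ?_
        have hz0 : 0 < ‖z‖ := norm_pos_iff.2 hz
        have hwz := hw0 z hz
        have hle : ‖w z‖ ≤ q * ‖z‖ := by
          have h := hGq (x + z) x
          rwa [add_sub_cancel_left, ← hwe] at h
        rw [hHe]
        rw [← ENNReal.ofReal_mul (by positivity), show G x + w z = G (x + z) by simp [hwe]]
        refine ENNReal.ofReal_le_ofReal ?_
        rw [← mul_div_assoc, div_le_div_iff₀ (by positivity) (by positivity)]
        have : ‖w z‖ ^ ((d : ℝ) + α) ≤ q ^ (α + d) * ‖z‖ ^ ((d : ℝ) + α) := by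
          rw [add_comm α, ← Real.mul_rpow hq hz0.le]
          exact Real.rpow_le_rpow hwz.le hle (by positivity)
        calc (f (G x) - f (G (x + z))) ^ 2 * ‖w z‖ ^ ((d : ℝ) + α)
            ≤ (f (G x) - f (G (x + z))) ^ 2 * (q ^ (α + d) * ‖z‖ ^ ((d : ℝ) + α)) := by gcongr
          _ = _ := by ring
    _ = ENNReal.ofReal (q ^ (α + d)) * ∫⁻ z in {0}ᶜ, H (w z) :=
        lintegral_const_mul _ (hH.comp hwm)
    _ ≤ ENNReal.ofReal (q ^ (α + d)) * ((K : ℝ≥0∞) ^ d * ∫⁻ z in {0}ᶜ, H z) := by gcongr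
    _ = ENNReal.ofReal (q ^ (α + d) / m ^ d) * ∫⁻ z in {0}ᶜ, H z := by
        rw [← mul_assoc]
        congr 1
        have : (K : ℝ≥0∞) = ENNReal.ofReal m⁻¹ := by
          rw [← hK, ENNReal.ofReal_coe_nnreal]
        rw [this, ← ENNReal.ofReal_pow (by positivity), ← ENNReal.ofReal_mul (by positivity),
          inv_pow, div_eq_mul_inv]

lemma levyEnergy_comp_le [IsProbabilityMeasure μ] (hα : 0 < α) {G : Euc d → Euc d} {q m : ℝ}
    (hq : 0 ≤ q) (hm : 0 < m) (hGq : ∀ x y, ‖G x - G y‖ ≤ q * ‖x - y‖)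
    (hGm : ∀ x y, m * ‖x - y‖ ≤ ‖G x - G y‖) (hG : Measurable G) (hf : Measurable f) :
    levyEnergy α μ (fun x => f (G x)) ≤
      ENNReal.ofReal (q ^ (α + d) / m ^ d) * levyEnergy α (μ.map G) f := by
  have hmeas : Measurable fun x => ∫⁻ z in {0}ᶜ,
      ENNReal.ofReal ((f x - f (x + z)) ^ 2 / ‖z‖ ^ ((d : ℝ) + α)) :=
    (measurable_incr hf).lintegral_prod_right'
  have : IsProbabilityMeasure (μ.map G) := Measure.isProbabilityMeasure_map hG.aemeasurable
  have hfG : Measurable fun x => f (G x) := hf.comp hG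
  have hmG : Measurable fun x => ∫⁻ z in {0}ᶜ,
      ENNReal.ofReal ((f (G x) - f (G x + z)) ^ 2 / ‖z‖ ^ ((d : ℝ) + α)) := hmeas.comp hG
  rw [levyEnergy_swap hf, lintegral_map hmeas hG, levyEnergy_swap hfG, ← lintegral_const_mul _ hmG]
  exact lintegral_mono (lintegral_incr_comp_le hα hq hm hGq hGm hG hf)

lemma varOf_map {G : Euc d → Euc d} (hG : Measurable G) (hf : Measurable f) :
    varOf (μ.map G) f = varOf μ (fun x => f (G x)) := by
  rw [varOf, varOf, integral_map hG.aemeasurable (hf.pow_const 2).aestronglyMeasurable,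
    integral_map hG.aemeasurable hf.aestronglyMeasurable]

lemma LipPoincare.map [IsProbabilityMeasure μ] (hα : 0 < α) {a : ℝ}
    (h : LipPoincare α μ a) {G : Euc d → Euc d} {q m : ℝ}
    (hq : 0 ≤ q) (hm : 0 < m) (hGq : ∀ x y, ‖G x - G y‖ ≤ q * ‖x - y‖)
    (hGm : ∀ x y, m * ‖x - y‖ ≤ ‖G x - G y‖) :
    LipPoincare α (μ.map G) (q ^ (α + d) / m ^ d * a) := by
  intro f N K hN hf
  have hGl : LipschitzWith ⟨q, hq⟩ G := LipschitzWith.of_dist_le_mul fun x y => by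
    rw [dist_eq_norm, dist_eq_norm]; exact hGq x y
  have hG : Measurable G := hGl.continuous.measurable
  have hfm : Measurable f := hf.continuous.measurable
  rw [varOf_map hG hfm]
  refine (h (fun x => f (G x)) N _ (fun x => hN _) (hf.comp hGl)).trans ?_
  refine (mul_le_mul_right (levyEnergy_comp_le hα hq hm hGq hGm hG hfm) _).trans_eq ?_
  rw [← mul_assoc, mul_comm (ENNReal.ofReal _), ← ENNReal.ofReal_mul (by positivity), mul_assoc]

/-- Covers the degenerate case `η = 1 / M`, `λ = M`, in which the gradient step is a constant map.
-/
lemma lipPoincare_dirac (c : Euc d) (a : ℝ) : LipPoincare α (Measure.dirac c) a := by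
  intro f N K hN hf
  simp [varOf]

end Pushforward

/-! ### Gaussian smoothing of bounded functions. -/

/-- The density of the centred Gaussian law with covariance `2 • 1` on `ℝ^d`. -/
def heatDensity (d : ℕ) (y : Euc d) : ℝ :=
  (4 * Real.pi) ^ (-(d : ℝ) / 2) * Real.exp (-(1 / 4) * ‖y‖ ^ 2)

/-- The centred Gaussian law with covariance `2 • 1` on `ℝ^d`. -/
def heatMeasure (d : ℕ) : Measure (Euc d) :=
  volume.withDensity fun y => ENNReal.ofReal (heatDensity d y)

section Heat

variable {d : ℕ} {f : Euc d → ℝ} {N : ℝ}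

lemma heatDensity_pos (y : Euc d) : 0 < heatDensity d y := by
  unfold heatDensity; positivity

lemma continuous_heatDensity : Continuous (heatDensity d) := by
  unfold heatDensity; fun_prop

lemma integral_heatDensity : ∫ y, heatDensity d y = 1 := by
  have h := GaussianFourier.integral_rexp_neg_mul_sq_norm (V := Euc d) (b := 1 / 4) (by norm_num)
  unfold heatDensity
  rw [integral_const_mul, h, finrank_euclideanSpace_fin, show Real.pi / (1 / 4) = 4 * Real.pi by ring,
    ← Real.rpow_add (by positivity), neg_div, neg_add_cancel, Real.rpow_zero]

lemma integrable_heatDensity : Integrable (heatDensity d) := by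
  by_contra h
  have := integral_heatDensity (d := d)
  rw [integral_undef h] at this
  norm_num at this

instance : IsProbabilityMeasure (heatMeasure d) := by
  refine ⟨?_⟩
  rw [heatMeasure, withDensity_apply _ .univ, setLIntegral_univ,
    ← ofReal_integral_eq_lintegral_ofReal integrable_heatDensity
      (.of_forall fun y => (heatDensity_pos y).le), integral_heatDensity, ENNReal.ofReal_one]

lemma integral_heatMeasure {F : Type*} [NormedAddCommGroup F] [NormedSpace ℝ F]
    (g : Euc d → F) : ∫ y, g y ∂(heatMeasure d) = ∫ y, heatDensity d y • g y := by
  rw [heatMeasure, integral_withDensity_eq_integral_toReal_smul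
    continuous_heatDensity.measurable.ennreal_ofReal (.of_forall fun _ => ENNReal.ofReal_lt_top)]
  simp_rw [ENNReal.toReal_ofReal (heatDensity_pos _).le]

lemma integrable_heatMeasure_iff {g : Euc d → ℝ} :
    Integrable g (heatMeasure d) ↔ Integrable fun y => heatDensity d y * g y := by
  rw [heatMeasure, integrable_withDensity_iff_integrable_smul'
    continuous_heatDensity.measurable.ennreal_ofReal (.of_forall fun _ => ENNReal.ofReal_lt_top)]
  simp_rw [ENNReal.toReal_ofReal (heatDensity_pos _).le, smul_eq_mul]

lemma charFun_heatMeasure (t : Euc d) :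
    charFun (heatMeasure d) t = Complex.exp (-((‖t‖ ^ 2 : ℝ) : ℂ)) := by
  have h := GaussianFourier.integral_cexp_neg_mul_sq_norm_add (V := Euc d) (b := 1 / 4)
    (by norm_num) Complex.I t
  rw [charFun_apply, integral_heatMeasure]
  have e : ∀ y : Euc d, heatDensity d y • Complex.exp ((inner ℝ y t : ℝ) * Complex.I) =
      (((4 * Real.pi) ^ (-(d : ℝ) / 2) : ℝ) : ℂ) *
        Complex.exp (-(1 / 4) * (‖y‖ : ℂ) ^ 2 + Complex.I * (inner ℝ t y : ℝ)) := by
    intro y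
    rw [Complex.exp_add, Complex.real_smul, heatDensity, real_inner_comm t y, mul_comm Complex.I]
    push_cast
    ring
  simp_rw [e]
  rw [integral_const_mul, h, finrank_euclideanSpace_fin, ← mul_assoc]
  have e2 : (((4 * Real.pi) ^ (-(d : ℝ) / 2) : ℝ) : ℂ) *
      (Real.pi / (1 / 4) : ℂ) ^ ((d : ℂ) / 2) = 1 := by
    rw [show (Real.pi / (1 / 4) : ℂ) = ((4 * Real.pi : ℝ) : ℂ) by push_cast; ring,
      show (d : ℂ) / 2 = (((d : ℝ) / 2 : ℝ) : ℂ) by push_cast; ring,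
      ← Complex.ofReal_cpow (by positivity), ← Complex.ofReal_mul,
      ← Real.rpow_add (by positivity), neg_div, neg_add_cancel, Real.rpow_zero, Complex.ofReal_one]
  rw [e2, one_mul, Complex.I_sq]
  congr 1
  push_cast
  ring

/-- The density of the translate of the Gaussian law with respect to the Gaussian law. -/
def shiftDensity (h y : Euc d) : ℝ := Real.exp (inner ℝ y h / 2 - ‖h‖ ^ 2 / 4)

lemma heatDensity_mul_shiftDensity (h y : Euc d) :
    heatDensity d y * shiftDensity h y = heatDensity d (y - h) := by
  rw [heatDensity, heatDensity, shiftDensity, mul_assoc, ← Real.exp_add, norm_sub_sq_real]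
  congr 2
  ring

lemma integral_heatMeasure_add (g : Euc d → ℝ) (h : Euc d) :
    ∫ y, g (y + h) ∂(heatMeasure d) = ∫ y, shiftDensity h y * g y ∂(heatMeasure d) := by
  rw [integral_heatMeasure, integral_heatMeasure,
    ← integral_sub_right_eq_self (fun y => heatDensity d y • g (y + h)) h]
  refine integral_congr_ae (.of_forall fun y => ?_)
  simp only [smul_eq_mul, sub_add_cancel]
  rw [← heatDensity_mul_shiftDensity, mul_assoc]

lemma integrable_shiftDensity (h : Euc d) : Integrable (shiftDensity h) (heatMeasure d) := by
  rw [integrable_heatMeasure_iff]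
  simp_rw [heatDensity_mul_shiftDensity]
  exact integrable_heatDensity.comp_sub_right h

lemma integral_shiftDensity (h : Euc d) : ∫ y, shiftDensity h y ∂(heatMeasure d) = 1 := by
  have := integral_heatMeasure_add (fun _ => (1 : ℝ)) h
  simpa using this.symm

/-- The square of an exponential tilt by `h` is, up to a constant, the tilt by `2 • h`; second
moments thus reduce to normalisation. -/
lemma shiftDensity_sq (h y : Euc d) :
    shiftDensity h y ^ 2 = Real.exp (‖h‖ ^ 2 / 2) * shiftDensity ((2 : ℝ) • h) y := by
  rw [shiftDensity, shiftDensity, ← Real.exp_nat_mul, ← Real.exp_add, inner_smul_right, norm_smul]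
  congr 1
  norm_num
  ring

lemma integrable_sq_shiftDensity_sub_one (h : Euc d) :
    Integrable (fun y => (shiftDensity h y - 1) ^ 2) (heatMeasure d) ∧
    ∫ y, (shiftDensity h y - 1) ^ 2 ∂(heatMeasure d) = Real.exp (‖h‖ ^ 2 / 2) - 1 := by
  have e : ∀ y, (shiftDensity h y - 1) ^ 2 =
      Real.exp (‖h‖ ^ 2 / 2) * shiftDensity ((2 : ℝ) • h) y - (2 * shiftDensity h y - 1) := by
    intro y; rw [← shiftDensity_sq]; ring
  simp_rw [e]
  have i1 := (integrable_shiftDensity ((2 : ℝ) • h)).const_mul (Real.exp (‖h‖ ^ 2 / 2))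
  have i2 := (integrable_shiftDensity h).const_mul 2
  have i3 : Integrable (fun y => 2 * shiftDensity h y - 1) (heatMeasure d) :=
    i2.sub (integrable_const (1 : ℝ))
  refine ⟨i1.sub i3, ?_⟩
  rw [integral_sub i1 i3, integral_sub i2 (integrable_const _), integral_const_mul,
    integral_const_mul, integral_shiftDensity, integral_shiftDensity]
  simp
  ring

/-- The mean square is `exp (‖h‖ ^ 2 / 2) - 1 ≤ ‖h‖ ^ 2` for `‖h‖ ≤ 1`; the first moment follows
from it by weighted AM–GM, without Cauchy–Schwarz. -/
lemma integral_abs_shiftDensity_sub_one_le {h : Euc d} (h0 : h ≠ 0) (h1 : ‖h‖ ≤ 1) :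
    ∫ y, |shiftDensity h y - 1| ∂(heatMeasure d) ≤ ‖h‖ := by
  have hp : 0 < ‖h‖ := norm_pos_iff.2 h0
  obtain ⟨hi, hv⟩ := integrable_sq_shiftDensity_sub_one h
  have hle : ∀ y, |shiftDensity h y - 1| ≤ ‖h‖ / 2 + (shiftDensity h y - 1) ^ 2 / (2 * ‖h‖) := by
    intro y
    rw [← sq_abs (shiftDensity h y - 1)]
    have : 0 ≤ (|shiftDensity h y - 1| - ‖h‖) ^ 2 / (2 * ‖h‖) := by positivity
    have e : (|shiftDensity h y - 1| - ‖h‖) ^ 2 / (2 * ‖h‖) =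
      ‖h‖ / 2 + |shiftDensity h y - 1| ^ 2 / (2 * ‖h‖) - |shiftDensity h y - 1| := by
        field_simp; ring
    linarith
  have hexp : Real.exp (‖h‖ ^ 2 / 2) - 1 ≤ ‖h‖ ^ 2 := by
    have hu : ‖h‖ ^ 2 ≤ 1 := pow_le_one₀ hp.le h1
    have := Real.abs_exp_sub_one_le (x := ‖h‖ ^ 2 / 2) (by rw [abs_of_nonneg (by positivity)]; linarith)
    rw [abs_of_nonneg (by positivity : 0 ≤ ‖h‖ ^ 2 / 2)] at this
    linarith [le_abs_self (Real.exp (‖h‖ ^ 2 / 2) - 1)]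
  have i1 : Integrable (fun y => |shiftDensity h y - 1|) (heatMeasure d) :=
    ((integrable_shiftDensity h).sub (integrable_const _)).abs
  have i2 : Integrable (fun y => (shiftDensity h y - 1) ^ 2 / (2 * ‖h‖)) (heatMeasure d) :=
    hi.div_const _
  have i3 : Integrable (fun _ => ‖h‖ / 2) (heatMeasure d) := integrable_const _
  refine (integral_mono i1 (i3.add i2) hle).trans ?_
  have e : ∫ y, (‖h‖ / 2 + (shiftDensity h y - 1) ^ 2 / (2 * ‖h‖)) ∂(heatMeasure d) =
      ‖h‖ / 2 + (Real.exp (‖h‖ ^ 2 / 2) - 1) / (2 * ‖h‖) := by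
    rw [integral_add i3 i2, integral_const, integral_div, hv]
    simp
  refine (show _ ≤ _ from e.le).trans ?_
  calc ‖h‖ / 2 + (Real.exp (‖h‖ ^ 2 / 2) - 1) / (2 * ‖h‖)
      ≤ ‖h‖ / 2 + ‖h‖ ^ 2 / (2 * ‖h‖) := by gcongr
    _ = ‖h‖ := by field_simp; ring

lemma abs_meanShift_heatMeasure_sub_le (hf : Measurable f) (hN : ∀ x, |f x| ≤ N) (x x' : Euc d) :
    |meanShift (heatMeasure d) f x - meanShift (heatMeasure d) f x'| ≤ 2 * N * ‖x - x'‖ := by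
  have hN0 : 0 ≤ N := (abs_nonneg _).trans (hN 0)
  rcases eq_or_ne x x' with rfl | hne
  · simp
  -- The density estimate is needed only at distance at most `1`; farther apart, the bound `2 * N`
  -- on the difference suffices.
  rcases le_or_gt ‖x - x'‖ 1 with h1 | h1
  · set h := x - x' with hh
    have hfx : Measurable fun y => f (x' + y) := hf.comp (measurable_const_add x')
    have e1 : meanShift (heatMeasure d) f x =
        ∫ y, shiftDensity h y * f (x' + y) ∂(heatMeasure d) := by
      rw [← integral_heatMeasure_add (fun y => f (x' + y)) h, meanShift]
      refine integral_congr_ae (.of_forall fun y => ?_)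
      simp only [hh]
      congr 1
      abel
    have i1 : Integrable (fun y => shiftDensity h y * f (x' + y)) (heatMeasure d) :=
      (integrable_shiftDensity h).mul_bdd hfx.aestronglyMeasurable (.of_forall fun y => hN _)
    have i2 : Integrable (fun y => |shiftDensity h y - 1|) (heatMeasure d) :=
      ((integrable_shiftDensity h).sub (integrable_const _)).abs
    rw [e1, meanShift, ← integral_sub i1 (integrable_of_abs_le hfx fun y => hN _)]
    calc |∫ y, (shiftDensity h y * f (x' + y) - f (x' + y)) ∂(heatMeasure d)|
        ≤ ∫ y, N * |shiftDensity h y - 1| ∂(heatMeasure d) := by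
          rw [← Real.norm_eq_abs]
          refine norm_integral_le_of_norm_le (i2.const_mul N) (.of_forall fun y => ?_)
          rw [← sub_one_mul, norm_mul, mul_comm]
          exact mul_le_mul_of_nonneg_right (hN _) (abs_nonneg _)
      _ ≤ N * ‖h‖ := by
          rw [integral_const_mul]
          gcongr
          exact integral_abs_shiftDensity_sub_one_le (sub_ne_zero.2 hne) h1
      _ ≤ 2 * N * ‖h‖ := by nlinarith [mul_nonneg hN0 (norm_nonneg h)]
  · calc |meanShift (heatMeasure d) f x - meanShift (heatMeasure d) f x'|
        ≤ N + N := (abs_sub _ _).trans (add_le_add (abs_meanShift_le hN x) (abs_meanShift_le hN x'))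
      _ ≤ 2 * N * ‖x - x'‖ := by nlinarith

end Heat

/-! ### Convolution powers and Laplace transforms of laws of random times. -/

/-- The `n`-fold convolution power of a measure. -/
def convPow {M : Type*} [AddMonoid M] [MeasurableSpace M] (μ : Measure M) : ℕ → Measure M
  | 0 => Measure.dirac 0
  | n + 1 => convPow μ n ∗ μ

instance {M : Type*} [AddMonoid M] [MeasurableSpace M] [MeasurableAdd₂ M] (μ : Measure M)
    [IsProbabilityMeasure μ] (n : ℕ) : IsProbabilityMeasure (convPow μ n) := by
  induction n with
  | zero => unfold convPow; infer_instance
  | succ n ih => unfold convPow; infer_instance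

lemma charFun_convPow {d : ℕ} (μ : Measure (Euc d)) [IsProbabilityMeasure μ] (n : ℕ) (t : Euc d) :
    charFun (convPow μ n) t = charFun μ t ^ n := by
  induction n with
  | zero => simp [convPow]
  | succ n ih => rw [convPow, charFun_conv, ih, pow_succ]

section Subordinator

variable {π : Measure ℝ} [IsProbabilityMeasure π]

lemma ae_nonneg_conv {π ρ : Measure ℝ} [SFinite π] [SFinite ρ] (hπ : ∀ᵐ s ∂π, 0 ≤ s)
    (hρ : ∀ᵐ s ∂ρ, 0 ≤ s) : ∀ᵐ s ∂(π ∗ ρ), 0 ≤ s := by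
  rw [Measure.conv, ae_map_iff (by fun_prop) measurableSet_Ici]
  filter_upwards [Measure.quasiMeasurePreserving_fst.ae hπ,
    Measure.quasiMeasurePreserving_snd.ae hρ] with p h1 h2
  exact add_nonneg h1 h2

lemma ae_nonneg_convPow (hπ : ∀ᵐ s ∂π, 0 ≤ s) (n : ℕ) : ∀ᵐ s ∂(convPow π n), 0 ≤ s := by
  induction n with
  | zero => rw [convPow, ae_dirac_iff measurableSet_Ici]
  | succ n ih => exact ae_nonneg_conv ih hπ

/-- The power must be at least one: the zeroth is the Dirac mass at `0`. -/
lemma ae_pos_convPow_succ (hπ : ∀ᵐ s ∂π, 0 < s) (n : ℕ) : ∀ᵐ s ∂(convPow π (n + 1)), 0 < s := by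
  rw [convPow, Measure.conv, ae_map_iff (by fun_prop) measurableSet_Ioi]
  filter_upwards [Measure.quasiMeasurePreserving_fst.ae
    (ae_nonneg_convPow (hπ.mono fun s hs => hs.le) n),
    Measure.quasiMeasurePreserving_snd.ae hπ] with p h1 h2
  exact add_pos_of_nonneg_of_pos h1 h2

/-- The Laplace transform of a measure on the real line. -/
def laplaceTransform (π : Measure ℝ) (u : ℝ) : ℝ := ∫ s, Real.exp (-(s * u)) ∂π

lemma integrable_exp_neg_mul (hπ : ∀ᵐ s ∂π, 0 ≤ s) {u : ℝ} (hu : 0 ≤ u) :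
    Integrable (fun s => Real.exp (-(s * u))) π := by
  refine Integrable.of_bound (by fun_prop) 1 ?_
  filter_upwards [hπ] with s hs
  rw [Real.norm_of_nonneg (Real.exp_pos _).le, Real.exp_le_one_iff]
  exact neg_nonpos.2 (mul_nonneg hs hu)

lemma laplaceTransform_convPow (hπ : ∀ᵐ s ∂π, 0 ≤ s) {u : ℝ} (hu : 0 ≤ u) (n : ℕ) :
    laplaceTransform (convPow π n) u = laplaceTransform π u ^ n := by
  induction n with
  | zero => simp [convPow, laplaceTransform]
  | succ n ih =>
    rw [pow_succ, ← ih, laplaceTransform, convPow, integral_conv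
      (integrable_exp_neg_mul (ae_nonneg_conv (ae_nonneg_convPow hπ n) hπ) hu)]
    simp_rw [add_mul, neg_add, Real.exp_add, integral_const_mul, integral_mul_const]
    rfl

/-- The tail bound for sums of independent nonnegative variables: the sum dominates each term. -/
lemma convPow_Iic_le (hπ : ∀ᵐ s ∂π, 0 ≤ s) (t : ℝ) (n : ℕ) :
    convPow π n (Set.Iic t) ≤ π (Set.Iic t) ^ n := by
  induction n with
  | zero => simpa using prob_le_one
  | succ n ih =>
    rw [convPow, Measure.conv, Measure.map_apply (by fun_prop) measurableSet_Iic, pow_succ]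
    calc ((convPow π n).prod π) ((fun p : ℝ × ℝ => p.1 + p.2) ⁻¹' Set.Iic t)
        ≤ ((convPow π n).prod π) (Set.Iic t ×ˢ Set.Iic t) := by
          refine measure_mono_ae ?_
          filter_upwards [Measure.quasiMeasurePreserving_fst.ae (ae_nonneg_convPow hπ n),
            Measure.quasiMeasurePreserving_snd.ae hπ] with p h1 h2 h
          have h : p.1 + p.2 ≤ t := h
          exact ⟨show p.1 ≤ t by linarith, show p.2 ≤ t by linarith⟩
      _ = convPow π n (Set.Iic t) * π (Set.Iic t) := Measure.prod_prod _ _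
      _ ≤ _ := by gcongr

end Subordinator

/-! ### Gaussian mixtures (subordination). -/

/-- The mixture over `s ~ π` of the centred Gaussian laws with covariance `2 s • 1` on `ℝ^d`. -/
def gaussMix (d : ℕ) (π : Measure ℝ) : Measure (Euc d) :=
  (π.prod (heatMeasure d)).map fun p => √p.1 • p.2

section Mixture

variable {d : ℕ} {π : Measure ℝ} [IsProbabilityMeasure π] {f : Euc d → ℝ} {N : ℝ}

lemma measurable_sqrt_smul : Measurable fun p : ℝ × Euc d => √p.1 • p.2 := by fun_prop

instance : IsProbabilityMeasure (gaussMix d π) :=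
  Measure.isProbabilityMeasure_map measurable_sqrt_smul.aemeasurable

/-- Given the time `s`, the characteristic function is `exp (-s ‖t‖ ^ 2)`. Subordination thus
reduces the exponent `‖t‖ ^ α` to a Laplace exponent `u ^ (α / 2)`. -/
lemma charFun_gaussMix (hπ : ∀ᵐ s ∂π, 0 ≤ s) (t : Euc d) :
    charFun (gaussMix d π) t = (laplaceTransform π (‖t‖ ^ 2) : ℂ) := by
  have hm : Measurable fun x : Euc d => Complex.exp ((inner ℝ x t : ℝ) * Complex.I) := by fun_prop
  have hi : Integrable (fun p : ℝ × Euc d =>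
      Complex.exp ((inner ℝ (√p.1 • p.2) t : ℝ) * Complex.I)) (π.prod (heatMeasure d)) := by
    refine Integrable.of_bound (hm.comp measurable_sqrt_smul).aestronglyMeasurable 1
      (.of_forall fun p => ?_)
    exact (Complex.norm_exp_ofReal_mul_I _).le
  rw [charFun_apply, gaussMix, integral_map measurable_sqrt_smul.aemeasurable
    hm.aestronglyMeasurable, integral_prod _ hi, laplaceTransform, ← integral_complex_ofReal]
  refine integral_congr_ae ?_
  filter_upwards [hπ] with s hs
  have := charFun_heatMeasure (√s • t)
  rw [charFun_apply] at this
  simp only [real_inner_smul_left]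
  simp only [real_inner_smul_right] at this
  rw [this, norm_smul, mul_pow, Real.norm_of_nonneg (Real.sqrt_nonneg s), Real.sq_sqrt hs]
  push_cast
  rfl

/-- A sum of independent Gaussian vectors with random times is a Gaussian vector run for the total
time, so smoothing estimates need only the law of that total. -/
lemma gaussMix_convPow (hπ : ∀ᵐ s ∂π, 0 ≤ s) (n : ℕ) :
    gaussMix d (convPow π n) = convPow (gaussMix d π) n := by
  refine Measure.ext_of_charFun (funext fun t => ?_)
  rw [charFun_gaussMix (ae_nonneg_convPow hπ n), charFun_convPow, charFun_gaussMix hπ,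
    laplaceTransform_convPow hπ (sq_nonneg _), Complex.ofReal_pow]

lemma meanShift_gaussMix (hf : Measurable f) (hN : ∀ x, |f x| ≤ N) (x : Euc d) :
    meanShift (gaussMix d π) f x = ∫ s, ∫ y, f (x + √s • y) ∂(heatMeasure d) ∂π := by
  have hm : Measurable fun y => f (x + y) := hf.comp (measurable_const_add x)
  rw [meanShift, gaussMix, integral_map measurable_sqrt_smul.aemeasurable hm.aestronglyMeasurable,
    integral_prod]
  exact Integrable.of_bound (hm.comp measurable_sqrt_smul).aestronglyMeasurable N
    (.of_forall fun p => hN _)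

/-- The unit-time bound applied to `y ↦ f (√s • y)`; rescaling produces the factor `(√s)⁻¹`. -/
lemma abs_integral_sqrt_smul_sub_le (hf : Measurable f) (hN : ∀ x, |f x| ≤ N) {s : ℝ} (hs : 0 < s)
    (x x' : Euc d) :
    |∫ y, f (x + √s • y) ∂(heatMeasure d) - ∫ y, f (x' + √s • y) ∂(heatMeasure d)| ≤
      2 * N * ‖x - x'‖ * (√s)⁻¹ := by
  have hr : 0 < √s := Real.sqrt_pos.2 hs
  have h := abs_meanShift_heatMeasure_sub_le (f := fun y => f (√s • y))
    (hf.comp (measurable_const_smul _)) (fun y => hN _) ((√s)⁻¹ • x) ((√s)⁻¹ • x')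
  simp only [meanShift, smul_add, smul_inv_smul₀ hr.ne'] at h
  refine h.trans_eq ?_
  rw [← smul_sub, norm_smul, norm_inv, Real.norm_of_nonneg hr.le]
  ring

lemma lipschitz_meanShift_gaussMix (hπ : ∀ᵐ s ∂π, 0 < s) {C : ℝ} (hC : 0 ≤ C)
    (hle : ∫⁻ s, ENNReal.ofReal (√s)⁻¹ ∂π ≤ ENNReal.ofReal C)
    (hf : Measurable f) (hN : ∀ x, |f x| ≤ N) (x x' : Euc d) :
    |meanShift (gaussMix d π) f x - meanShift (gaussMix d π) f x'| ≤ 2 * N * C * ‖x - x'‖ := by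
  have hN0 : 0 ≤ N := (abs_nonneg _).trans (hN 0)
  have hsm : ∀ x, Measurable fun s : ℝ => ∫ y, f (x + √s • y) ∂(heatMeasure d) := by
    intro x
    have : StronglyMeasurable (Function.uncurry fun (s : ℝ) (y : Euc d) => f (x + √s • y)) :=
      (hf.comp ((measurable_const_add x).comp measurable_sqrt_smul)).stronglyMeasurable
    exact this.integral_prod_right.measurable
  have hi : ∀ x, Integrable (fun s : ℝ => ∫ y, f (x + √s • y) ∂(heatMeasure d)) π := by
    intro x
    refine Integrable.of_bound (hsm x).aestronglyMeasurable N (.of_forall fun s => ?_)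
    simpa using norm_integral_le_of_norm_le_const (μ := heatMeasure d)
      (f := fun y => f (x + √s • y)) (.of_forall fun y => hN _)
  rw [meanShift_gaussMix hf hN, meanShift_gaussMix hf hN, ← integral_sub (hi x) (hi x'),
    ← ENNReal.ofReal_le_ofReal_iff (by positivity), ← Real.enorm_eq_ofReal_abs]
  refine (enorm_integral_le_lintegral_enorm _).trans ?_
  calc ∫⁻ s, ‖(∫ y, f (x + √s • y) ∂(heatMeasure d)) -
          ∫ y, f (x' + √s • y) ∂(heatMeasure d)‖ₑ ∂π
      ≤ ∫⁻ s, ENNReal.ofReal (2 * N * ‖x - x'‖) * ENNReal.ofReal (√s)⁻¹ ∂π := by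
        refine lintegral_mono_ae ?_
        filter_upwards [hπ] with s hs
        rw [Real.enorm_eq_ofReal_abs, ← ENNReal.ofReal_mul (by positivity)]
        exact ENNReal.ofReal_le_ofReal (abs_integral_sqrt_smul_sub_le hf hN hs x x')
    _ = ENNReal.ofReal (2 * N * ‖x - x'‖) * ∫⁻ s, ENNReal.ofReal (√s)⁻¹ ∂π :=
        lintegral_const_mul _ (by fun_prop)
    _ ≤ ENNReal.ofReal (2 * N * ‖x - x'‖) * ENNReal.ofReal C := by gcongr
    _ = _ := by
        rw [← ENNReal.ofReal_mul (by positivity)]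
        congr 1
        ring

/-- The density of the centred Gaussian law with covariance `2 s • 1`. -/
def scaledHeatDensity (d : ℕ) (s : ℝ) (z : Euc d) : ℝ :=
  (4 * Real.pi) ^ (-(d : ℝ) / 2) * (s ^ (-(d : ℝ) / 2) * Real.exp (-(‖z‖ ^ 2 / 4 * s⁻¹)))

lemma lintegral_sqrt_smul {h : Euc d → ℝ≥0∞} (hh : Measurable h) {s : ℝ} (hs : 0 < s) :
    ∫⁻ y, h (√s • y) ∂(heatMeasure d) =
      ∫⁻ z, ENNReal.ofReal (scaledHeatDensity d s z) * h z := by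
  have hr : 0 < √s := Real.sqrt_pos.2 hs
  have hd : Measurable fun y : Euc d => ENNReal.ofReal (heatDensity d y) :=
    continuous_heatDensity.measurable.ennreal_ofReal
  have hF : Measurable fun z : Euc d => ENNReal.ofReal (heatDensity d ((√s)⁻¹ • z)) * h z :=
    (hd.comp (measurable_const_smul _)).mul hh
  have h1 : ∫⁻ y, h (√s • y) ∂(heatMeasure d) =
      ∫⁻ y, ENNReal.ofReal (heatDensity d y) * h (√s • y) := by
    have hs : Measurable fun y => h (√s • y) := hh.comp (measurable_const_smul _)
    rw [heatMeasure, lintegral_withDensity_eq_lintegral_mul _ hd hs]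
    rfl
  have h2 : ∫⁻ y, ENNReal.ofReal (heatDensity d y) * h (√s • y) =
      ∫⁻ z, ENNReal.ofReal (heatDensity d ((√s)⁻¹ • z)) * h z
        ∂(Measure.map (fun y => √s • y) volume) := by
    rw [lintegral_map hF (measurable_const_smul _)]
    simp_rw [inv_smul_smul₀ hr.ne']
  rw [h1, h2, Measure.map_addHaar_smul _ hr.ne', lintegral_smul_measure, smul_eq_mul,
    ← lintegral_const_mul _ hF]
  refine lintegral_congr fun z => ?_
  rw [← mul_assoc, ← ENNReal.ofReal_mul (abs_nonneg _)]
  congr 2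
  rw [finrank_euclideanSpace_fin, abs_of_pos (by positivity), heatDensity, scaledHeatDensity,
    norm_smul, norm_inv, Real.norm_of_nonneg hr.le, mul_pow, inv_pow, Real.sq_sqrt hs.le]
  have : (√s ^ d)⁻¹ = s ^ (-(d : ℝ) / 2) := by
    rw [Real.sqrt_eq_rpow, ← Real.rpow_natCast, ← Real.rpow_mul hs.le, ← Real.rpow_neg hs.le]
    congr 1
    ring
  rw [this, show -(1 / 4) * (s⁻¹ * ‖z‖ ^ 2) = -(‖z‖ ^ 2 / 4 * s⁻¹) by ring]
  ring

lemma lintegral_gaussMix (hπ : ∀ᵐ s ∂π, 0 < s) {h : Euc d → ℝ≥0∞} (hh : Measurable h) :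
    ∫⁻ x, h x ∂(gaussMix d π) =
      ∫⁻ z, (∫⁻ s, ENNReal.ofReal (scaledHeatDensity d s z) ∂π) * h z := by
  have hm : Measurable fun p : ℝ × Euc d => ENNReal.ofReal (scaledHeatDensity d p.1 p.2) := by
    unfold scaledHeatDensity; fun_prop
  have hs : Measurable fun p : ℝ × Euc d => h (√p.1 • p.2) := hh.comp measurable_sqrt_smul
  rw [gaussMix, lintegral_map hh measurable_sqrt_smul, lintegral_prod _ hs.aemeasurable]
  have e : ∫⁻ s, ∫⁻ y, h (√s • y) ∂(heatMeasure d) ∂π =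
      ∫⁻ s, (∫⁻ z, ENNReal.ofReal (scaledHeatDensity d s z) * h z) ∂π := by
    refine lintegral_congr_ae ?_
    filter_upwards [hπ] with s hs using lintegral_sqrt_smul hh hs
  rw [e, lintegral_lintegral_swap (f := fun s z => ENNReal.ofReal (scaledHeatDensity d s z) * h z)
    (hm.mul (hh.comp measurable_snd)).aemeasurable]
  refine lintegral_congr fun z => ?_
  exact lintegral_mul_const _ (hm.comp measurable_prodMk_right)

end Mixture

/-! ### Pareto times approximating the one-sided stable law. -/

section Pareto

variable {r c : ℝ}

lemma integrableOn_one_sub_exp_mul_rpow (h0 : 0 < r) (h1 : r < 1) {u : ℝ} (hu : 0 ≤ u) :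
    IntegrableOn (fun s : ℝ => (1 - Real.exp (-(s * u))) * s ^ (-(r + 1))) (Set.Ioi 0) := by
  have hm : Measurable fun s : ℝ => (1 - Real.exp (-(s * u))) * s ^ (-(r + 1)) := by fun_prop
  have hn : ∀ s : ℝ, 0 < s → 0 ≤ 1 - Real.exp (-(s * u)) := fun s hs => by
    rw [sub_nonneg, Real.exp_le_one_iff]
    exact neg_nonpos.2 (mul_nonneg hs.le hu)
  rw [← Set.Ioc_union_Ioi_eq_Ioi zero_le_one]
  refine IntegrableOn.union ?_ ?_
  · have hi : IntegrableOn (fun s : ℝ => u * s ^ (-r)) (Set.Ioc 0 1) := by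
      refine Integrable.const_mul ?_ _
      have := intervalIntegral.intervalIntegrable_rpow' (a := 0) (b := 1) (r := -r) (by linarith)
      rwa [intervalIntegrable_iff_integrableOn_Ioc_of_le zero_le_one] at this
    refine Integrable.mono' hi hm.aestronglyMeasurable ?_
    refine (ae_restrict_iff' measurableSet_Ioc).2 (.of_forall fun s hs => ?_)
    rw [Real.norm_of_nonneg (mul_nonneg (hn s hs.1) (Real.rpow_nonneg hs.1.le _))]
    have h2 : 1 - Real.exp (-(s * u)) ≤ s * u := by
      linarith [Real.add_one_le_exp (-(s * u))]
    calc (1 - Real.exp (-(s * u))) * s ^ (-(r + 1)) ≤ s * u * s ^ (-(r + 1)) := by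
          gcongr
          exact Real.rpow_nonneg hs.1.le _
      _ = u * (s ^ (1 : ℝ) * s ^ (-(r + 1))) := by rw [Real.rpow_one]; ring
      _ = u * s ^ (-r) := by rw [← Real.rpow_add hs.1]; ring_nf
  · refine Integrable.mono' (integrableOn_Ioi_rpow_of_lt (a := -(r + 1)) (by linarith) zero_lt_one)
      hm.aestronglyMeasurable ?_
    refine (ae_restrict_iff' measurableSet_Ioi).2 (.of_forall fun s hs => ?_)
    have hs0 : 0 < s := zero_lt_one.trans hs
    rw [Real.norm_of_nonneg (mul_nonneg (hn s hs0) (Real.rpow_nonneg hs0.le _))]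
    refine mul_le_of_le_one_left (Real.rpow_nonneg hs0.le _) ?_
    linarith [Real.exp_pos (-(s * u))]

/-- Integration by parts reduces this to the Gamma integral with exponent `1 - r`. It is the
Lévy–Khintchine formula for the one-sided `r`-stable law. -/
lemma integral_one_sub_exp_mul_rpow (h0 : 0 < r) (h1 : r < 1) {u : ℝ} (hu : 0 ≤ u) :
    ∫ s in Set.Ioi (0 : ℝ), (1 - Real.exp (-(s * u))) * s ^ (-(r + 1)) =
      u ^ r * (Real.Gamma (1 - r) / r) := by
  rcases hu.eq_or_lt with rfl | hu0
  · simp [Real.zero_rpow h0.ne']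
  have hG : IntegrableOn (fun s : ℝ => s ^ (-r) * Real.exp (-(u * s))) (Set.Ioi 0) := by
    have := integrableOn_rpow_mul_exp_neg_mul_rpow (p := 1) (s := -r) (b := u) (by linarith)
      zero_lt_one hu0
    simpa using this
  have hGv : ∫ s in Set.Ioi (0 : ℝ), s ^ (-r) * Real.exp (-(u * s)) =
      (1 / u) ^ (1 - r) * Real.Gamma (1 - r) := by
    have := Real.integral_rpow_mul_exp_neg_mul_Ioi (a := 1 - r) (r := u) (by linarith) hu0
    rw [← this]
    ring_nf
  have hn : ∀ s : ℝ, 0 < s → 0 ≤ 1 - Real.exp (-(s * u)) := fun s hs => by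
    rw [sub_nonneg, Real.exp_le_one_iff]
    exact neg_nonpos.2 (mul_nonneg hs.le hu)
  -- Both boundary terms vanish: at `0` because `1 - exp (-(s * u)) ≤ s * u` and `r < 1`, at
  -- infinity because `r > 0`.
  have key := integral_Ioi_mul_deriv_eq_deriv_mul (a := 0) (a' := 0) (b' := 0)
    (u := fun s : ℝ => 1 - Real.exp (-(s * u))) (u' := fun s => u * Real.exp (-(u * s)))
    (v := fun s : ℝ => -r⁻¹ * s ^ (-r)) (v' := fun s => s ^ (-(r + 1))) ?_ ?_ ?_ ?_ ?_ ?_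
  · rw [key]
    have e : ∀ s : ℝ, u * Real.exp (-(u * s)) * (-r⁻¹ * s ^ (-r)) =
      -(u / r) * (s ^ (-r) * Real.exp (-(u * s))) := fun s => by field_simp
    simp_rw [e]
    rw [integral_const_mul, hGv, one_div, Real.inv_rpow hu0.le, ← Real.rpow_neg hu0.le]
    have : u * u ^ (-(1 - r)) = u ^ r := by
      nth_rw 1 [← Real.rpow_one u]
      rw [← Real.rpow_add hu0]
      ring_nf
    rw [← this]
    ring
  · intro s hs
    have h := ((hasDerivAt_mul_const (x := s) u).fun_neg).exp.const_sub 1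
    convert! h using 1
    ring_nf
  · intro s hs
    have h := (Real.hasDerivAt_rpow_const (x := s) (p := -r) (.inl (ne_of_gt hs))).const_mul (-r⁻¹)
    convert! h using 1
    rw [show -(r + 1) = -r - 1 by ring]
    field_simp
  · exact integrableOn_one_sub_exp_mul_rpow h0 h1 hu
  · have := hG.const_mul (-(u / r))
    refine this.congr (.of_forall fun s => ?_)
    simp only [Pi.mul_apply]
    field_simp
  · have hlim : Tendsto (fun s : ℝ => r⁻¹ * (u * s ^ (1 - r))) (𝓝[>] 0) (𝓝 0) := by
      have : Tendsto (fun s : ℝ => s ^ (1 - r)) (𝓝[>] 0) (𝓝 0) := by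
        have h := (Real.continuous_rpow_const (q := 1 - r) (by linarith)).tendsto 0
        rw [Real.zero_rpow (by linarith)] at h
        exact h.mono_left nhdsWithin_le_nhds
      simpa using (this.const_mul u).const_mul r⁻¹
    refine squeeze_zero_norm' ?_ hlim
    filter_upwards [self_mem_nhdsWithin] with s hs
    have hs : 0 < s := hs
    have h2 : 1 - Real.exp (-(s * u)) ≤ s * u := by
      linarith [Real.add_one_le_exp (-(s * u))]
    simp only [Pi.mul_apply]
    rw [norm_mul, norm_mul, norm_neg, Real.norm_of_nonneg (hn s hs),
      Real.norm_of_nonneg (by positivity), Real.norm_of_nonneg (by positivity)]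
    calc (1 - Real.exp (-(s * u))) * (r⁻¹ * s ^ (-r)) ≤ s * u * (r⁻¹ * s ^ (-r)) := by gcongr
      _ = r⁻¹ * (u * (s ^ (1 : ℝ) * s ^ (-r))) := by rw [Real.rpow_one]; ring
      _ = r⁻¹ * (u * s ^ (1 - r)) := by rw [← Real.rpow_add hs]; ring_nf
  · have hlim : Tendsto (fun s : ℝ => r⁻¹ * s ^ (-r)) atTop (𝓝 0) := by
      simpa using (tendsto_rpow_neg_atTop h0).const_mul r⁻¹
    refine squeeze_zero_norm' ?_ hlim
    filter_upwards [eventually_gt_atTop 0] with s hs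
    simp only [Pi.mul_apply]
    rw [norm_mul, norm_mul, norm_neg, Real.norm_of_nonneg (hn s hs),
      Real.norm_of_nonneg (by positivity), Real.norm_of_nonneg (by positivity)]
    refine mul_le_of_le_one_left (by positivity) ?_
    linarith [Real.exp_pos (-(s * u))]

lemma ae_pos_paretoMeasure {ε : ℝ} (hε : 0 < ε) : ∀ᵐ s ∂(paretoMeasure ε r), 0 < s := by
  rw [paretoMeasure, ae_withDensity_iff (by unfold paretoPDF; fun_prop)]
  refine .of_forall fun s hs => ?_
  by_contra h
  exact hs (paretoPDF_of_lt (by linarith))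

lemma integral_paretoMeasure {ε : ℝ} (hε : 0 < ε) (h0 : 0 < r) (g : ℝ → ℝ) :
    ∫ s, g s ∂(paretoMeasure ε r) = ∫ s in Set.Ici ε, r * ε ^ r * s ^ (-(r + 1)) * g s := by
  have hm : Measurable (paretoPDF ε r) := by unfold paretoPDF; fun_prop
  rw [paretoMeasure, integral_withDensity_eq_integral_toReal_smul hm
    (.of_forall fun _ => ENNReal.ofReal_lt_top), ← integral_indicator measurableSet_Ici]
  refine integral_congr_ae (.of_forall fun s => ?_)
  simp only [paretoPDF]
  rw [ENNReal.toReal_ofReal (paretoPDFReal_nonneg hε.le h0.le s), smul_eq_mul]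
  simp only [paretoPDFReal, Set.indicator, Set.mem_Ici]
  split_ifs <;> simp

lemma one_sub_laplaceTransform_paretoMeasure {ε : ℝ} (hε : 0 < ε) (h0 : 0 < r) {u : ℝ}
    (hu : 0 ≤ u) : 1 - laplaceTransform (paretoMeasure ε r) u =
      r * ε ^ r * ∫ s in Set.Ici ε, (1 - Real.exp (-(s * u))) * s ^ (-(r + 1)) := by
  have := isProbabilityMeasure_paretoMeasure hε h0
  have hp := ae_pos_paretoMeasure (r := r) hε
  have h := integral_sub (integrable_const (1 : ℝ))
    (integrable_exp_neg_mul (hp.mono fun s hs => hs.le) hu)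
  rw [integral_const, probReal_univ, one_smul] at h
  rw [laplaceTransform, ← h, integral_paretoMeasure hε h0, ← integral_const_mul]
  refine integral_congr_ae (.of_forall fun s => ?_)
  ring

/-- The lower cutoff of the Pareto laws in the approximation of the stable law. -/
def paretoCutoff (r c : ℝ) (n : ℕ) : ℝ := (c / (n + 1)) ^ (1 / r)

lemma paretoCutoff_pos (hc : 0 < c) (n : ℕ) : 0 < paretoCutoff r c n := by
  unfold paretoCutoff; positivity

/-- The Pareto tail beyond `t` is `ε ^ r * t ^ (-r)`. This cutoff makes it `c * t ^ (-r) / (n + 1)`,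
so that `n + 1` independent times have the expected number of jumps above `t` of the limit law. -/
lemma paretoCutoff_rpow (h0 : 0 < r) (hc : 0 < c) (n : ℕ) :
    paretoCutoff r c n ^ r = c / (n + 1) := by
  rw [paretoCutoff, ← Real.rpow_mul (by positivity), one_div, inv_mul_cancel₀ h0.ne', Real.rpow_one]

lemma tendsto_paretoCutoff (h0 : 0 < r) : Tendsto (paretoCutoff r c) atTop (𝓝 0) := by
  have h1 : Tendsto (fun n : ℕ => c / ((n : ℝ) + 1)) atTop (𝓝 0) := by
    have := (tendsto_one_div_add_atTop_nhds_zero_nat (𝕜 := ℝ)).const_mul c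
    simpa [div_eq_mul_inv] using this
  have h2 := (Real.continuous_rpow_const (q := 1 / r) (by positivity)).tendsto 0
  rw [Real.zero_rpow (by positivity)] at h2
  exact h2.comp h1

lemma tendsto_mul_one_sub_laplaceTransform (h0 : 0 < r) (h1 : r < 1) (hc : 0 < c) {u : ℝ}
    (hu : 0 ≤ u) :
    Tendsto (fun n : ℕ => ((n : ℝ) + 1) *
      (1 - laplaceTransform (paretoMeasure (paretoCutoff r c n) r) u)) atTop
      (𝓝 (c * Real.Gamma (1 - r) * u ^ r)) := by
  let F : ℝ → ℝ := fun s => (1 - Real.exp (-(s * u))) * s ^ (-(r + 1))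
  have hF : IntegrableOn F (Set.Ioi 0) := integrableOn_one_sub_exp_mul_rpow h0 h1 hu
  have hFm : Measurable F := by unfold F; fun_prop
  have e : ∀ n : ℕ, ((n : ℝ) + 1) *
      (1 - laplaceTransform (paretoMeasure (paretoCutoff r c n) r) u) =
      r * c * ∫ s in Set.Ioi 0, (Set.Ici (paretoCutoff r c n)).indicator F s := by
    intro n
    have hsub : Set.Ici (paretoCutoff r c n) ⊆ Set.Ioi 0 := fun s hs =>
      (paretoCutoff_pos hc n).trans_le hs
    rw [one_sub_laplaceTransform_paretoMeasure (paretoCutoff_pos hc n) h0 hu,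
      paretoCutoff_rpow h0 hc, setIntegral_indicator measurableSet_Ici,
      Set.inter_eq_self_of_subset_right hsub]
    field_simp
    rfl
  simp_rw [e]
  have hlim : Tendsto (fun n => ∫ s in Set.Ioi 0, (Set.Ici (paretoCutoff r c n)).indicator F s)
      atTop (𝓝 (∫ s in Set.Ioi 0, F s)) := by
    refine tendsto_integral_of_dominated_convergence (fun s => ‖F s‖)
      (fun n => (hFm.indicator measurableSet_Ici).aestronglyMeasurable) hF.norm
      (fun n => .of_forall fun s => norm_indicator_le_norm_self _ _) ?_
    refine (ae_restrict_iff' measurableSet_Ioi).2 (.of_forall fun s hs => ?_)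
    refine tendsto_const_nhds.congr' ?_
    filter_upwards [(tendsto_paretoCutoff (c := c) h0).eventually_le_const hs] with n hn
    rw [Set.indicator_of_mem (show s ∈ Set.Ici _ from hn)]
  have := hlim.const_mul (r * c)
  rw [show ∫ s in Set.Ioi 0, F s = _ from integral_one_sub_exp_mul_rpow h0 h1 hu] at this
  convert! this using 2
  field_simp

lemma tendsto_laplaceTransform (h0 : 0 < r) (h1 : r < 1) (hc : 0 < c) {u : ℝ} (hu : 0 ≤ u) :
    Tendsto (fun n => laplaceTransform (paretoMeasure (paretoCutoff r c n) r) u) atTop (𝓝 1) := by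
  have h := (tendsto_mul_one_sub_laplaceTransform h0 h1 hc hu).mul
    (tendsto_one_div_add_atTop_nhds_zero_nat (𝕜 := ℝ))
  rw [mul_zero] at h
  have h2 := h.const_sub 1
  rw [sub_zero] at h2
  refine h2.congr fun n => ?_
  field_simp
  ring

lemma tendsto_laplaceTransform_pow (h0 : 0 < r) (h1 : r < 1) (hc : 0 < c) {u : ℝ} (hu : 0 ≤ u) :
    Tendsto (fun n => laplaceTransform (paretoMeasure (paretoCutoff r c n) r) u ^ (n + 1)) atTop
      (𝓝 (Real.exp (-(c * Real.Gamma (1 - r) * u ^ r)))) := by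
  -- The shift to `n - 1` matches the `n`-th power in the exponential limit with the `n + 1` factors
  -- at cutoff index `n`.
  let g : ℕ → ℝ := fun n => laplaceTransform (paretoMeasure (paretoCutoff r c (n - 1)) r) u - 1
  have hg : Tendsto (fun n : ℕ => n * g n) atTop (𝓝 (-(c * Real.Gamma (1 - r) * u ^ r))) := by
    rw [← tendsto_add_atTop_iff_nat 1]
    refine (tendsto_mul_one_sub_laplaceTransform h0 h1 hc hu).neg.congr fun n => ?_
    simp only [g, Nat.add_sub_cancel]
    push_cast
    ring
  have := Real.tendsto_one_add_pow_exp_of_tendsto hg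
  rw [← tendsto_add_atTop_iff_nat 1] at this
  refine this.congr fun n => ?_
  simp [g]

lemma paretoMeasure_Iic_le {ε : ℝ} (hε : 0 < ε) (h0 : 0 < r) {t : ℝ} (ht : 0 < t) :
    paretoMeasure ε r (Set.Iic t) ≤ ENNReal.ofReal (Real.exp (-(ε ^ r * t ^ (-r)))) := by
  have := isProbabilityMeasure_paretoMeasure hε h0
  rcases lt_or_ge t ε with h | h
  · rw [paretoMeasure, withDensity_apply _ measurableSet_Iic]
    have : ∫⁻ s in Set.Iic t, paretoPDF ε r s = ∫⁻ s in Set.Iic t, 0 :=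
      setLIntegral_congr_fun measurableSet_Iic fun s hs => paretoPDF_of_lt (lt_of_le_of_lt hs h)
    rw [this]
    simp
  · have e : (paretoMeasure ε r).real (Set.Ioi t) = ε ^ r * t ^ (-r) := by
      rw [measureReal_def, paretoMeasure, withDensity_apply _ measurableSet_Ioi]
      have : ∫⁻ s in Set.Ioi t, paretoPDF ε r s =
          ∫⁻ s in Set.Ioi t, ENNReal.ofReal (r * ε ^ r * s ^ (-(r + 1))) :=
        setLIntegral_congr_fun measurableSet_Ioi fun s hs =>
          paretoPDF_of_le (h.trans (le_of_lt hs))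
      rw [this, ← integral_eq_lintegral_of_nonneg_ae, integral_const_mul,
        integral_Ioi_rpow_of_lt (by linarith) ht]
      · rw [show -(r + 1) + 1 = -r by ring]
        field_simp
      · refine (ae_restrict_iff' measurableSet_Ioi).2 (.of_forall fun s hs => ?_)
        have : 0 < s := ht.trans hs
        positivity
      · exact Measurable.aestronglyMeasurable (by fun_prop)
    rw [← ofReal_measureReal]
    refine ENNReal.ofReal_le_ofReal ?_
    rw [← Set.compl_Ioi, probReal_compl_eq_one_sub measurableSet_Ioi, e]
    exact Real.one_sub_le_exp_neg _

/-- By the layer-cake formula the integral is that of the probability that the total time is less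
than `t ^ (-2)`. All `n + 1` times must then be small, which has probability at most `exp (-c * t ^
(2 * r))`, independently of `n`. -/
lemma exists_lintegral_inv_sqrt_le (h0 : 0 < r) (hc : 0 < c) : ∃ C : ℝ, 0 ≤ C ∧ ∀ n,
    ∫⁻ s, ENNReal.ofReal (√s)⁻¹ ∂(convPow (paretoMeasure (paretoCutoff r c n) r) (n + 1)) ≤
      ENNReal.ofReal C := by
  have hi : IntegrableOn (fun t : ℝ => Real.exp (-c * t ^ (2 * r))) (Set.Ioi 0) := by
    have := integrableOn_rpow_mul_exp_neg_mul_rpow (p := 2 * r) (s := 0) (b := c) (by norm_num)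
      (by positivity) hc
    simpa using this
  refine ⟨∫ t in Set.Ioi 0, Real.exp (-c * t ^ (2 * r)), by positivity, fun n => ?_⟩
  have hε := paretoCutoff_pos (r := r) hc n
  have := isProbabilityMeasure_paretoMeasure hε h0
  have hp := (ae_pos_paretoMeasure (r := r) hε).mono fun s hs => hs.le
  rw [lintegral_eq_lintegral_meas_lt _ (.of_forall fun s => by positivity) (by fun_prop),
    ofReal_integral_eq_lintegral_ofReal hi (.of_forall fun t => (Real.exp_pos _).le)]
  refine setLIntegral_mono' measurableSet_Ioi fun t ht => ?_
  have ht : 0 < t := ht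
  have hsub : {s : ℝ | t < (√s)⁻¹} ⊆ Set.Iic (t ^ (-2 : ℝ)) := by
    intro s hs
    have hs : t < (√s)⁻¹ := hs
    rcases le_or_gt s 0 with h | h
    · exact h.trans (by positivity)
    · have hq : 0 < √s := Real.sqrt_pos.2 h
      have h2 : √s ≤ t⁻¹ := by
        rw [← inv_inv (√s)]
        exact inv_anti₀ ht hs.le
      calc s = √s ^ 2 := (Real.sq_sqrt h.le).symm
        _ ≤ t⁻¹ ^ 2 := by gcongr
        _ = t ^ (-2 : ℝ) := by rw [Real.rpow_neg ht.le, Real.rpow_two, inv_pow]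
  refine (measure_mono hsub).trans ((convPow_Iic_le hp _ _).trans ?_)
  refine (pow_le_pow_left' (paretoMeasure_Iic_le hε h0 (by positivity)) _).trans_eq ?_
  rw [← ENNReal.ofReal_pow (Real.exp_pos _).le, ← Real.exp_nat_mul, paretoCutoff_rpow h0 hc,
    ← Real.rpow_mul ht.le]
  congr 2
  push_cast
  rw [show (-2 : ℝ) * -r = 2 * r by ring]
  field_simp

end Pareto

/-! ### Comparison of the mixed Gaussian density with the Lévy density. -/

section Density

variable {d : ℕ} {α : ℝ}

/-- The substitution `s ↦ s⁻¹` turns this into a Gamma integral. -/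
lemma integral_rpow_mul_exp_neg_mul_inv {a b : ℝ} (ha : 0 < a) (hb : 0 < b) :
    IntegrableOn (fun s : ℝ => s ^ (-1 - a) * Real.exp (-(b * s⁻¹))) (Set.Ioi 0) ∧
    ∫ s in Set.Ioi (0 : ℝ), s ^ (-1 - a) * Real.exp (-(b * s⁻¹)) =
      b ^ (-a) * Real.Gamma a := by
  let g : ℝ → ℝ := fun y => y ^ (a - 1) * Real.exp (-(b * y))
  have hg : IntegrableOn g (Set.Ioi 0) := by
    have := integrableOn_rpow_mul_exp_neg_mul_rpow (p := 1) (s := a - 1) (b := b) (by linarith)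
      zero_lt_one hb
    simpa [g] using this
  have e : ∀ s ∈ Set.Ioi (0 : ℝ), (|(-1 : ℝ)| * s ^ ((-1 : ℝ) - 1)) • g (s ^ (-1 : ℝ)) =
      s ^ (-1 - a) * Real.exp (-(b * s⁻¹)) := by
    intro s hs
    have hs : 0 < s := hs
    simp only [g, Real.rpow_neg_one, abs_neg, abs_one, one_mul, smul_eq_mul]
    rw [← Real.rpow_neg_one s, ← Real.rpow_mul hs.le, ← mul_assoc, ← Real.rpow_add hs]
    ring_nf
  refine ⟨?_, ?_⟩
  · exact ((integrableOn_Ioi_comp_rpow_iff g (p := -1) (by norm_num)).2 hg).congr_fun e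
      measurableSet_Ioi
  · rw [← setIntegral_congr_fun measurableSet_Ioi e, integral_comp_rpow_Ioi g (by norm_num),
      Real.integral_rpow_mul_exp_neg_mul_Ioi ha hb, one_div, Real.inv_rpow hb.le,
      Real.rpow_neg hb.le]

lemma stableConst_eq {z : Euc d} (hz : z ≠ 0) :
    α / 2 * (Real.Gamma (1 - α / 2))⁻¹ * (4 * Real.pi) ^ (-(d : ℝ) / 2) *
      ((‖z‖ ^ 2 / 4) ^ (-(α / 2 + d / 2)) * Real.Gamma (α / 2 + d / 2)) =
      stableConst α d * (‖z‖ ^ ((d : ℝ) + α))⁻¹ := by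
  have hz0 : 0 < ‖z‖ := norm_pos_iff.2 hz
  have e1 : (‖z‖ ^ 2 / 4) ^ (-(α / 2 + d / 2)) =
      (‖z‖ ^ ((d : ℝ) + α))⁻¹ * (2 : ℝ) ^ ((d : ℝ) + α) := by
    rw [show ‖z‖ ^ 2 / 4 = (‖z‖ / 2) ^ (2 : ℝ) by rw [Real.rpow_two]; ring,
      ← Real.rpow_mul (by positivity), Real.div_rpow hz0.le (by norm_num),
      show (2 : ℝ) * -(α / 2 + d / 2) = -((d : ℝ) + α) by ring, Real.rpow_neg hz0.le,
      Real.rpow_neg (by norm_num : (0 : ℝ) ≤ 2), div_inv_eq_mul]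
  have e2 : (4 * Real.pi) ^ (-(d : ℝ) / 2) = (2 : ℝ) ^ (-(d : ℝ)) * Real.pi ^ (-(d : ℝ) / 2) := by
    rw [Real.mul_rpow (by norm_num) Real.pi_pos.le, show (4 : ℝ) = 2 ^ (2 : ℝ) by norm_num,
      ← Real.rpow_mul (by norm_num)]
    congr 2
    ring
  have e3 : (2 : ℝ) ^ (-(d : ℝ)) * (2 : ℝ) ^ ((d : ℝ) + α) = 2 * (2 : ℝ) ^ (α - 1) := by
    rw [← Real.rpow_add (by norm_num), Real.rpow_sub_one (by norm_num)]
    rw [show -(d : ℝ) + (d + α) = α by ring]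
    ring
  rw [e1, e2, stableConst, show α / 2 + (d : ℝ) / 2 = (α + d) / 2 by ring]
  calc _ = α / 2 * (Real.Gamma (1 - α / 2))⁻¹ * Real.pi ^ (-(d : ℝ) / 2) *
        (‖z‖ ^ ((d : ℝ) + α))⁻¹ * Real.Gamma ((α + d) / 2) *
        ((2 : ℝ) ^ (-(d : ℝ)) * (2 : ℝ) ^ ((d : ℝ) + α)) := by ring
    _ = _ := by rw [e3]; ring

/-- Dropping the cutoff, i.e. integrating the Pareto density formula over all `s > 0`, only
increases the integral and makes it explicit. The Lévy density thus bounds the jump density for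
every cutoff, not just in the limit. -/
lemma lintegral_scaledHeatDensity_le (h0 : 0 < α) (h2 : α < 2) {ε : ℝ} (hε : 0 < ε)
    {z : Euc d} (hz : z ≠ 0) :
    ∫⁻ s, ENNReal.ofReal (scaledHeatDensity d s z) ∂(paretoMeasure ε (α / 2)) ≤
      ENNReal.ofReal (ε ^ (α / 2) * Real.Gamma (1 - α / 2) * stableConst α d *
        (‖z‖ ^ ((d : ℝ) + α))⁻¹ ) := by
  have hΓ : 0 < Real.Gamma (1 - α / 2) := Real.Gamma_pos_of_pos (by linarith)
  have hz0 : 0 < ‖z‖ := norm_pos_iff.2 hz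
  set a : ℝ := α / 2 + d / 2 with ha
  set b : ℝ := ‖z‖ ^ 2 / 4 with hb
  set A : ℝ := α / 2 * ε ^ (α / 2) * (4 * Real.pi) ^ (-(d : ℝ) / 2) with hA
  have hA0 : 0 ≤ A := by positivity
  obtain ⟨hi, hv⟩ := integral_rpow_mul_exp_neg_mul_inv (a := a) (b := b) (by positivity)
    (by positivity)
  have hm1 : Measurable (paretoPDF ε (α / 2)) := by unfold paretoPDF; fun_prop
  have hm2 : Measurable fun s : ℝ => ENNReal.ofReal (scaledHeatDensity d s z) := by
    unfold scaledHeatDensity; fun_prop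
  rw [paretoMeasure, lintegral_withDensity_eq_lintegral_mul _ hm1 hm2]
  calc ∫⁻ s, (paretoPDF ε (α / 2) * fun s => ENNReal.ofReal (scaledHeatDensity d s z)) s
      ≤ ∫⁻ s, (Set.Ioi (0 : ℝ)).indicator (fun s =>
          ENNReal.ofReal (A * (s ^ (-1 - a) * Real.exp (-(b * s⁻¹))))) s := by
        refine lintegral_mono fun s => ?_
        rw [Pi.mul_apply]
        rcases lt_or_ge s ε with h | h
        · rw [paretoPDF_of_lt h, zero_mul]; exact zero_le
        · have hs : 0 < s := hε.trans_le h
          rw [paretoPDF_of_le h, Set.indicator_of_mem (show s ∈ Set.Ioi 0 from hs),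
            ← ENNReal.ofReal_mul (by positivity), scaledHeatDensity]
          refine ENNReal.ofReal_le_ofReal (le_of_eq ?_)
          have : s ^ (-1 - a) = s ^ (-(α / 2 + 1)) * s ^ (-(d : ℝ) / 2) := by
            rw [← Real.rpow_add hs, ha]
            ring_nf
          rw [this, hA]
          ring
    _ = ENNReal.ofReal (A * (b ^ (-a) * Real.Gamma a)) := by
        rw [lintegral_indicator measurableSet_Ioi, ← hv, ← integral_const_mul,
          ofReal_integral_eq_lintegral_ofReal (hi.const_mul A)]
        refine (ae_restrict_iff' measurableSet_Ioi).2 (.of_forall fun s hs => ?_)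
        have hs : 0 < s := hs
        positivity
    _ ≤ _ := by
        refine ENNReal.ofReal_le_ofReal (le_of_eq ?_)
        rw [mul_assoc _ (stableConst α d), ← stableConst_eq hz, hA]
        calc _ = α / 2 * ε ^ (α / 2) * (4 * Real.pi) ^ (-(d : ℝ) / 2) * (b ^ (-a) * Real.Gamma a) *
              (Real.Gamma (1 - α / 2) * (Real.Gamma (1 - α / 2))⁻¹) := by
              rw [mul_inv_cancel₀ hΓ.ne', mul_one]
          _ = _ := by ring

end Density

/-! ### Jump approximation of the stable law and its Poincaré inequality. -/

/-- The approximating jump law of the stable law with characteristic function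
`exp (- s ‖t‖ ^ α)`. -/
def jumpLaw (d : ℕ) (α s : ℝ) (n : ℕ) : Measure (Euc d) :=
  gaussMix d (paretoMeasure (paretoCutoff (α / 2) (s / Real.Gamma (1 - α / 2)) n) (α / 2))

/-- `p` has characteristic function `t ↦ exp (- s ‖t‖ ^ α)`. -/
def IsStableLaw {d : ℕ} (α s : ℝ) (p : Measure (Euc d)) : Prop :=
  ∀ t, charFun p t = Complex.exp (-((s * ‖t‖ ^ α : ℝ) : ℂ))

section JumpLaw

variable {d : ℕ} {α s : ℝ}

lemma div_Gamma_pos (h2 : α < 2) (hs : 0 < s) : 0 < s / Real.Gamma (1 - α / 2) :=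
  div_pos hs (Real.Gamma_pos_of_pos (by linarith))

lemma isProbabilityMeasure_jumpLaw (h0 : 0 < α) (h2 : α < 2) (hs : 0 < s) (n : ℕ) :
    IsProbabilityMeasure (jumpLaw d α s n) := by
  have := isProbabilityMeasure_paretoMeasure
    (paretoCutoff_pos (r := α / 2) (div_Gamma_pos h2 hs) n) (r := α / 2) (by linarith)
  unfold jumpLaw
  infer_instance

lemma stableConst_nonneg (h0 : 0 < α) (h2 : α < 2) : 0 ≤ stableConst α d := by
  have h1 : 0 < Real.Gamma (1 - α / 2) := Real.Gamma_pos_of_pos (by linarith)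
  have h3 : 0 < Real.Gamma ((α + d) / 2) := Real.Gamma_pos_of_pos (by positivity)
  unfold stableConst
  positivity

/-- The cutoff satisfies `ε ^ (α / 2) * Γ(1 - α / 2) = s / (n + 1)`, so the number of jumps cancels
exactly against the density bound. -/
lemma lintegral_jumpLaw_le (hd : 0 < d) (h0 : 0 < α) (h2 : α < 2) (hs : 0 < s) (n : ℕ)
    {h : Euc d → ℝ≥0∞} (hh : Measurable h) :
    ((n + 1 : ℕ) : ℝ≥0∞) * ∫⁻ z, h z ∂(jumpLaw d α s n) ≤
      ENNReal.ofReal (s * stableConst α d) * ∫⁻ z in {0}ᶜ, levyWeight d α z * h z := by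
  have hΓ : 0 < Real.Gamma (1 - α / 2) := Real.Gamma_pos_of_pos (by linarith)
  have hc := div_Gamma_pos h2 hs
  have hε := paretoCutoff_pos (r := α / 2) hc n
  have hr : 0 < α / 2 := by linarith
  have hC := stableConst_nonneg (d := d) h0 h2
  have := isProbabilityMeasure_paretoMeasure hε hr
  have hn : Nontrivial (Euc d) := by
    have : Nonempty (Fin d) := ⟨⟨0, hd⟩⟩
    infer_instance
  have hm : Measurable fun p : ℝ × Euc d => ENNReal.ofReal (scaledHeatDensity d p.1 p.2) := by
    unfold scaledHeatDensity; fun_prop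
  have hm1 : Measurable fun z => (∫⁻ s, ENNReal.ofReal (scaledHeatDensity d s z)
      ∂(paretoMeasure (paretoCutoff (α / 2) (s / Real.Gamma (1 - α / 2)) n) (α / 2))) * h z :=
    hm.lintegral_prod_left'.mul hh
  have hm2 : Measurable fun z => levyWeight d α z * h z := measurable_levyWeight.mul hh
  rw [jumpLaw, lintegral_gaussMix (ae_pos_paretoMeasure hε) hh, ← lintegral_const_mul _ hm1,
    ← lintegral_const_mul _ hm2]
  -- The origin is a null set because `d > 0`.
  have hae : ∀ᵐ z : Euc d, z ∈ ({0}ᶜ : Set (Euc d)) :=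
    compl_mem_ae_iff.2 (measure_singleton 0)
  rw [Measure.restrict_eq_self_of_ae_mem hae]
  refine lintegral_mono_ae ?_
  filter_upwards [hae] with z hz
  have hle := lintegral_scaledHeatDensity_le h0 h2 hε hz
  rw [paretoCutoff_rpow hr hc, div_mul_eq_mul_div, div_mul_cancel₀ _ hΓ.ne'] at hle
  rw [← mul_assoc, ← mul_assoc]
  refine mul_le_mul_left ?_ _
  refine (mul_le_mul_right hle _).trans_eq ?_
  rw [levyWeight, ← ENNReal.ofReal_natCast, ← ENNReal.ofReal_mul (by positivity),
    ← ENNReal.ofReal_mul (by positivity)]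
  congr 1
  push_cast
  field_simp

lemma charFun_jumpLaw (h0 : 0 < α) (h2 : α < 2) (hs : 0 < s) (n : ℕ) (t : Euc d) :
    charFun (jumpLaw d α s n) t = (laplaceTransform (paretoMeasure
      (paretoCutoff (α / 2) (s / Real.Gamma (1 - α / 2)) n) (α / 2)) (‖t‖ ^ 2) : ℂ) := by
  have hε := paretoCutoff_pos (r := α / 2) (div_Gamma_pos h2 hs) n
  have := isProbabilityMeasure_paretoMeasure hε (r := α / 2) (by linarith)
  exact charFun_gaussMix ((ae_pos_paretoMeasure hε).mono fun s hs => hs.le) t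

lemma tendsto_charFun_jumpLaw_pow_succ (h0 : 0 < α) (h2 : α < 2) (hs : 0 < s) (t : Euc d) :
    Tendsto (fun n => charFun (jumpLaw d α s n) t ^ (n + 1)) atTop
      (𝓝 (Complex.exp (-((s * ‖t‖ ^ α : ℝ) : ℂ)))) := by
  have hΓ : 0 < Real.Gamma (1 - α / 2) := Real.Gamma_pos_of_pos (by linarith)
  have h := tendsto_laplaceTransform_pow (r := α / 2) (by linarith) (by linarith)
    (div_Gamma_pos h2 hs) (sq_nonneg ‖t‖)
  rw [div_mul_cancel₀ _ hΓ.ne', ← Real.rpow_two, ← Real.rpow_mul (norm_nonneg t),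
    mul_div_cancel₀ _ (two_ne_zero)] at h
  have h3 := (Complex.continuous_ofReal.tendsto _).comp h
  rw [Complex.ofReal_exp, Complex.ofReal_neg] at h3
  refine h3.congr fun n => ?_
  rw [charFun_jumpLaw h0 h2 hs]
  simp

/-- A single factor tends to `1`, so dropping one does not change the limit. Efron–Stein bounds a
variance under the power `n + 1` by increments under the power `n`, so both limits are required. -/
lemma tendsto_charFun_jumpLaw_pow (h0 : 0 < α) (h2 : α < 2) (hs : 0 < s) (t : Euc d) :
    Tendsto (fun n => charFun (jumpLaw d α s n) t ^ n) atTop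
      (𝓝 (Complex.exp (-((s * ‖t‖ ^ α : ℝ) : ℂ)))) := by
  have h := tendsto_laplaceTransform (r := α / 2) (by linarith) (by linarith)
    (div_Gamma_pos h2 hs) (sq_nonneg ‖t‖)
  have h1 : Tendsto (fun n => charFun (jumpLaw d α s n) t) atTop (𝓝 1) := by
    simp_rw [charFun_jumpLaw h0 h2 hs]
    have := (Complex.continuous_ofReal.tendsto _).comp h
    rwa [Complex.ofReal_one] at this
  have h3 := (tendsto_charFun_jumpLaw_pow_succ h0 h2 hs t).div h1 one_ne_zero
  rw [div_one] at h3
  refine h3.congr' ?_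
  filter_upwards [h1.eventually_ne one_ne_zero] with n hn
  rw [Pi.div_apply, pow_succ, mul_div_cancel_right₀ _ hn]

lemma tendsto_integral_of_tendsto_charFun {μs : ℕ → Measure (Euc d)} {p : Measure (Euc d)}
    [hμ : ∀ n, IsProbabilityMeasure (μs n)] [hp : IsProbabilityMeasure p]
    (h : ∀ t, Tendsto (fun n => charFun (μs n) t) atTop (𝓝 (charFun p t))) {f : Euc d → ℝ} {N : ℝ}
    (hf : Continuous f) (hN : ∀ x, |f x| ≤ N) :
    Tendsto (fun n => ∫ x, f x ∂(μs n)) atTop (𝓝 (∫ x, f x ∂p)) := by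
  let ms : ℕ → ProbabilityMeasure (Euc d) := fun n => ⟨μs n, hμ n⟩
  let m : ProbabilityMeasure (Euc d) := ⟨p, hp⟩
  have hw : Tendsto ms atTop (𝓝 m) := ProbabilityMeasure.tendsto_iff_tendsto_charFun.2 h
  exact (ProbabilityMeasure.tendsto_iff_forall_integral_tendsto.1 hw)
    (BoundedContinuousFunction.ofNormedAddCommGroup f hf N hN)

/-- The variance under a convolution is at most the mean square increment plus the variance of
the average. -/
lemma ofReal_varOf_conv_le_incr {μ κ : Measure (Euc d)} [IsProbabilityMeasure μ]
    [IsProbabilityMeasure κ] {f : Euc d → ℝ} {N : ℝ} (hf : Measurable f) (hN : ∀ x, |f x| ≤ N) :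
    ENNReal.ofReal (varOf (μ ∗ κ) f) ≤
      ∫⁻ z, ∫⁻ x, ENNReal.ofReal ((f x - f (x + z)) ^ 2) ∂μ ∂κ +
        ENNReal.ofReal (varOf μ (meanShift κ f)) := by
  have hb : ∀ x z, |(f x - f (x + z)) ^ 2| ≤ (N + N) ^ 2 := fun x z =>
    abs_sq_le_sq ((abs_sub _ _).trans (add_le_add (hN _) (hN _)))
  have hm : ∀ x, Measurable fun z => f (x + z) := fun x => hf.comp (measurable_const_add x)
  have h1 : Measurable fun p : Euc d × Euc d => f p.2 := hf.comp measurable_snd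
  have h2 : Measurable fun p : Euc d × Euc d => f (p.2 + p.1) :=
    hf.comp (measurable_snd.add measurable_fst)
  rw [lintegral_lintegral_swap (f := fun z x => ENNReal.ofReal ((f x - f (x + z)) ^ 2))
    (by fun_prop)]
  refine ofReal_varOf_conv_le hf hN fun x => ?_
  have hi : Integrable (fun z => (f x - f (x + z)) ^ 2) κ :=
    integrable_of_abs_le ((measurable_const.sub (hm x)).pow_const 2) (hb x)
  rw [← ofReal_integral_eq_lintegral_ofReal hi (.of_forall fun z => sq_nonneg _)]
  refine ENNReal.ofReal_le_ofReal ?_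
  have e : ∫ z, (f x - f (x + z)) ^ 2 ∂κ =
      f x ^ 2 - 2 * f x * ∫ z, f (x + z) ∂κ + ∫ z, f (x + z) ^ 2 ∂κ := by
    have i1 : Integrable (fun z => f (x + z)) κ := integrable_of_abs_le (hm x) fun z => hN _
    have i2 : Integrable (fun z => f (x + z) ^ 2) κ :=
      integrable_of_abs_le ((hm x).pow_const 2) fun z => abs_sq_le_sq (hN _)
    have i3 : Integrable (fun z => f x ^ 2 - 2 * f x * f (x + z)) κ :=
      (integrable_const _).sub (i1.const_mul _)
    simp_rw [sub_sq]
    rw [integral_add i3 i2, integral_sub (integrable_const _) (i1.const_mul _),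
      integral_const_mul]
    simp
  rw [e, varOf]
  -- The second moment about `f x` exceeds the variance by exactly this square.
  nlinarith [sq_nonneg (f x - ∫ z, f (x + z) ∂κ)]

/-- The Efron–Stein inequality for convolution powers. -/
lemma ofReal_varOf_convPow_le {κ : Measure (Euc d)} [IsProbabilityMeasure κ] (j : ℕ) :
    ∀ {f : Euc d → ℝ} {N : ℝ}, Measurable f → (∀ x, |f x| ≤ N) →
    ENNReal.ofReal (varOf (convPow κ (j + 1)) f) ≤ ((j + 1 : ℕ) : ℝ≥0∞) *
      ∫⁻ z, ∫⁻ x, ENNReal.ofReal ((f x - f (x + z)) ^ 2) ∂(convPow κ j) ∂κ := by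
  induction j with
  | zero =>
    intro f N hf hN
    have := ofReal_varOf_conv_le_incr (μ := convPow κ 0) (κ := κ) hf hN
    simpa [convPow, varOf] using this
  | succ j ih =>
    intro f N hf hN
    -- Splitting off the last factor gives one increment term; the induction hypothesis for the
    -- average gives `j + 1` more, each bounded by that same term through Jensen.
    refine (ofReal_varOf_conv_le_incr (μ := convPow κ (j + 1)) hf hN).trans ?_
    have h1 := ih (measurable_meanShift (ν := κ) hf) (abs_meanShift_le (ν := κ) hN)
    have h2 : ∫⁻ z, ∫⁻ x, ENNReal.ofReal ((meanShift κ f x - meanShift κ f (x + z)) ^ 2)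
        ∂(convPow κ j) ∂κ ≤
        ∫⁻ z, ∫⁻ x, ENNReal.ofReal ((f x - f (x + z)) ^ 2) ∂(convPow κ (j + 1)) ∂κ :=
      lintegral_mono fun z => lintegral_sq_meanShift_sub_le hf hN z
    calc _ ≤ ∫⁻ z, ∫⁻ x, ENNReal.ofReal ((f x - f (x + z)) ^ 2) ∂(convPow κ (j + 1)) ∂κ +
          ((j + 1 : ℕ) : ℝ≥0∞) *
          ∫⁻ z, ∫⁻ x, ENNReal.ofReal ((f x - f (x + z)) ^ 2) ∂(convPow κ (j + 1)) ∂κ := by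
            gcongr
            exact h1.trans (by gcongr)
      _ = _ := by
        push_cast
        ring

/-- The Poincaré inequality of the stable law. -/
lemma IsStableLaw.lipPoincare (hd : 0 < d) (h0 : 0 < α) (h2 : α < 2) (hs : 0 < s)
    {p : Measure (Euc d)} [IsProbabilityMeasure p] (hp : IsStableLaw α s p) :
    LipPoincare α p s := by
  intro f N K hN hf
  have hfm : Measurable f := hf.continuous.measurable
  have hpr := isProbabilityMeasure_jumpLaw (d := d) h0 h2 hs
  have hc1 : ∀ t, Tendsto (fun n => charFun (convPow (jumpLaw d α s n) (n + 1)) t) atTop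
      (𝓝 (charFun p t)) := fun t => by
    simp_rw [charFun_convPow, hp t]
    exact tendsto_charFun_jumpLaw_pow_succ h0 h2 hs t
  have hc2 : ∀ t, Tendsto (fun n => charFun (convPow (jumpLaw d α s n) n) t) atTop
      (𝓝 (charFun p t)) := fun t => by
    simp_rw [charFun_convPow, hp t]
    exact tendsto_charFun_jumpLaw_pow h0 h2 hs t
  have hV : Tendsto (fun n => varOf (convPow (jumpLaw d α s n) (n + 1)) f) atTop
      (𝓝 (varOf p f)) :=
    (tendsto_integral_of_tendsto_charFun hc1 (hf.continuous.pow 2)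
      fun x => abs_sq_le_sq (hN x)).sub
      ((tendsto_integral_of_tendsto_charFun hc1 hf.continuous hN).pow 2)
  have hE : Tendsto (fun n => levyEnergy α (convPow (jumpLaw d α s n) n) f) atTop
      (𝓝 (levyEnergy α p f)) := by
    refine tendsto_levyEnergy hd h0 h2 (fun _ => hf) (fun _ => hN) hfm fun z => ?_
    have hb : ∀ x, |(f x - f (x + z)) ^ 2| ≤ (N + N) ^ 2 := fun x =>
      abs_sq_le_sq ((abs_sub _ _).trans (add_le_add (hN _) (hN _)))
    have hc : Continuous fun x => (f x - f (x + z)) ^ 2 :=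
      (hf.continuous.sub (hf.continuous.comp (continuous_add_const z))).pow 2
    have h := (ENNReal.continuous_ofReal.tendsto _).comp
      (tendsto_integral_of_tendsto_charFun hc2 hc hb)
    rw [ofReal_integral_eq_lintegral_ofReal (integrable_of_abs_le hc.measurable hb)
      (.of_forall fun x => sq_nonneg _)] at h
    refine h.congr fun n => ?_
    exact ofReal_integral_eq_lintegral_ofReal (integrable_of_abs_le hc.measurable hb)
      (.of_forall fun x => sq_nonneg _)
  refine le_of_tendsto_of_tendsto' ((ENNReal.continuous_ofReal.tendsto _).comp hV)
    (ENNReal.Tendsto.const_mul hE (.inr ENNReal.ofReal_ne_top)) fun n => ?_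
  refine (ofReal_varOf_convPow_le n hfm hN).trans ?_
  rw [levyEnergy_eq hfm]
  exact lintegral_jumpLaw_le hd h0 h2 hs n (measurable_lintegral_sq_sub hfm)

/-- Convolution with the stable law turns bounded continuous functions into Lipschitz functions. -/
lemma IsStableLaw.exists_lipschitzWith_meanShift (h0 : 0 < α) (h2 : α < 2) (hs : 0 < s)
    {p : Measure (Euc d)} [IsProbabilityMeasure p] (hp : IsStableLaw α s p)
    {f : Euc d → ℝ} {N : ℝ} (hf : Continuous f) (hN : ∀ x, |f x| ≤ N) :
    ∃ K : ℝ≥0, LipschitzWith K (meanShift p f) := by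
  have hpr := isProbabilityMeasure_jumpLaw (d := d) h0 h2 hs
  have hN0 : 0 ≤ N := (abs_nonneg _).trans (hN 0)
  have hc1 : ∀ t, Tendsto (fun n => charFun (convPow (jumpLaw d α s n) (n + 1)) t) atTop
      (𝓝 (charFun p t)) := fun t => by
    simp_rw [charFun_convPow, hp t]
    exact tendsto_charFun_jumpLaw_pow_succ h0 h2 hs t
  obtain ⟨C, hC0, hC⟩ := exists_lintegral_inv_sqrt_le (r := α / 2) (by linarith)
    (div_Gamma_pos h2 hs)
  have hlim : ∀ x, Tendsto (fun n => meanShift (convPow (jumpLaw d α s n) (n + 1)) f x) atTop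
      (𝓝 (meanShift p f x)) := fun x =>
    tendsto_integral_of_tendsto_charFun hc1 (hf.comp (continuous_const_add x)) fun y => hN _
  refine ⟨⟨2 * N * C, by positivity⟩, LipschitzWith.of_dist_le_mul fun x x' => ?_⟩
  rw [Real.dist_eq, dist_eq_norm]
  refine le_of_tendsto' ((hlim x).sub (hlim x')).abs fun n => ?_
  have hε := paretoCutoff_pos (r := α / 2) (div_Gamma_pos h2 hs) n
  have := isProbabilityMeasure_paretoMeasure hε (r := α / 2) (by linarith)
  have hpos := ae_pos_paretoMeasure (r := α / 2) hε
  -- Rewritten as one Gaussian mixture over the total time, whose inverse square root has mean at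
  -- most `C`.
  rw [jumpLaw, ← gaussMix_convPow (hpos.mono fun s hs => hs.le)]
  exact lipschitz_meanShift_gaussMix (ae_pos_convPow_succ hpos n) hC0 (hC n) hf.measurable hN x x'

end JumpLaw

/-! ### From bounded Lipschitz back to square-integrable differentiable functions. -/

section Regularization

variable {d : ℕ} {α s a : ℝ} {ν p : Measure (Euc d)}

lemma IsStableLaw.map_smul (hp : IsStableLaw α s p) {r θ : ℝ} (hr : 0 ≤ r)
    (hθ : r ^ α = θ) : IsStableLaw α (θ * s) (p.map fun x => r • x) := by
  intro t
  rw [charFun_map_smul, hp, norm_smul, Real.norm_of_nonneg hr,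
    Real.mul_rpow hr (norm_nonneg t), hθ]
  ring_nf

lemma IsStableLaw.conv_eq [IsProbabilityMeasure p] {p₁ p₂ : Measure (Euc d)}
    [IsProbabilityMeasure p₁] [IsProbabilityMeasure p₂] {s₁ s₂ : ℝ} (h : IsStableLaw α s p)
    (h₁ : IsStableLaw α s₁ p₁) (h₂ : IsStableLaw α s₂ p₂) (hs : s₁ + s₂ = s) : p₁ ∗ p₂ = p := by
  refine Measure.ext_of_charFun (funext fun t => ?_)
  rw [charFun_conv, h, h₁, h₂, ← Complex.exp_add, ← hs]
  congr 1
  push_cast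
  ring

/-- The mean square increments over vanishing perturbations vanish. -/
lemma tendsto_lintegral_incr [IsProbabilityMeasure ν] [IsProbabilityMeasure p]
    {f : Euc d → ℝ} {N : ℝ} (hf : Continuous f) (hN : ∀ x, |f x| ≤ N) {b c : ℕ → ℝ}
    (hb : Tendsto b atTop (𝓝 1)) (hc : Tendsto c atTop (𝓝 0)) :
    Tendsto (fun n => ∫⁻ z, ∫⁻ x, ENNReal.ofReal ((f x - f (x + z)) ^ 2)
      ∂(ν ∗ p.map fun x => b n • x) ∂(p.map fun x => c n • x)) atTop (𝓝 0) := by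
  let F : ℕ → Euc d × (Euc d × Euc d) → ℝ := fun n q =>
    (f (q.2.1 + b n • q.2.2) - f (q.2.1 + b n • q.2.2 + c n • q.1)) ^ 2
  have hF : ∀ n, Measurable (F n) := fun n => by
    refine Continuous.measurable ?_
    unfold F
    fun_prop
  -- Transferring the scalings from the measures to the integrand leaves a fixed product measure,
  -- where bounded convergence applies.
  have e : ∀ n, ∫⁻ z, ∫⁻ x, ENNReal.ofReal ((f x - f (x + z)) ^ 2)
      ∂(ν ∗ p.map fun x => b n • x) ∂(p.map fun x => c n • x) =
      ∫⁻ q, ENNReal.ofReal (F n q) ∂(p.prod (ν.prod p)) := by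
    intro n
    have hpr : IsProbabilityMeasure (p.map fun x => b n • x) :=
      Measure.isProbabilityMeasure_map (measurable_const_smul _).aemeasurable
    rw [lintegral_map (measurable_lintegral_sq_sub hf.measurable) (measurable_const_smul _),
      lintegral_prod _ (hF n).ennreal_ofReal.aemeasurable]
    refine lintegral_congr fun y => ?_
    have h1 : Measurable fun x => ENNReal.ofReal ((f x - f (x + c n • y)) ^ 2) := by
      have : Continuous fun x => (f x - f (x + c n • y)) ^ 2 := by fun_prop
      exact this.measurable.ennreal_ofReal
    have h2 : Measurable fun q : Euc d × Euc d => ENNReal.ofReal (F n (y, q)) :=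
      ((hF n).comp measurable_prodMk_left).ennreal_ofReal
    rw [Measure.lintegral_conv h1, lintegral_prod _ h2.aemeasurable]
    refine lintegral_congr fun x => ?_
    have h3 : Measurable fun u => ENNReal.ofReal ((f (x + u) - f (x + u + c n • y)) ^ 2) :=
      h1.comp (measurable_const_add x)
    rw [lintegral_map h3 (measurable_const_smul _)]
  simp_rw [e]
  have h := tendsto_lintegral_of_bounded (m := p.prod (ν.prod p)) (g := fun _ => 0) hF
    (C := (N + N) ^ 2) (fun n q => abs_sq_le_sq ((abs_sub _ _).trans (add_le_add (hN _) (hN _))))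
    (fun q => ?_)
  · simpa using h
  · have h1 : Tendsto (fun n => q.2.1 + b n • q.2.2) atTop (𝓝 (q.2.1 + (1 : ℝ) • q.2.2)) :=
      tendsto_const_nhds.add (hb.smul_const _)
    have h2 : Tendsto (fun n => q.2.1 + b n • q.2.2 + c n • q.1) atTop
        (𝓝 (q.2.1 + (1 : ℝ) • q.2.2 + (0 : ℝ) • q.1)) := h1.add (hc.smul_const _)
    have h3 := (((hf.tendsto _).comp h1).sub ((hf.tendsto _).comp h2)).pow 2
    rw [zero_smul, add_zero, sub_self, zero_pow two_ne_zero] at h3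
    exact h3

/-- Split `p` into independent stable parts of scales `(1 - θ) * s` and `θ * s`. Averaging over the
small part makes `f` Lipschitz, so the inequality for `ν` convolved with the large part applies; its
energy is at most that of `ν ∗ p`, and the remaining mean square increment vanishes as `θ → 0`. The
Lipschitz constant may blow up, since it does not enter the inequality. -/
lemma LipPoincare.conv_stable_of_continuous [IsProbabilityMeasure ν] [IsProbabilityMeasure p]
    (hd : 0 < d) (h0 : 0 < α) (h2 : α < 2) (ha : 0 ≤ a) (hs : 0 < s) (hν : LipPoincare α ν a)
    (hp : IsStableLaw α s p) {f : Euc d → ℝ} {N : ℝ} (hf : Continuous f) (hN : ∀ x, |f x| ≤ N) :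
    ENNReal.ofReal (varOf (ν ∗ p) f) ≤
      ENNReal.ofReal ((a + s) * stableConst α d) * levyEnergy α (ν ∗ p) f := by
  have hC := stableConst_nonneg (d := d) h0 h2
  -- The `+ 2` keeps `θ 0 < 1`, so the large part is never degenerate.
  let θ : ℕ → ℝ := fun n => 1 / ((n : ℝ) + 2)
  have hθ0 : ∀ n, 0 < θ n := fun n => by positivity
  have hθ1 : ∀ n, θ n < 1 := fun n => by
    rw [div_lt_one (by positivity)]
    have : (0 : ℝ) ≤ n := n.cast_nonneg
    linarith
  have hθ : Tendsto θ atTop (𝓝 0) := by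
    have := (tendsto_add_atTop_iff_nat 1).2 (tendsto_one_div_add_atTop_nhds_zero_nat (𝕜 := ℝ))
    refine this.congr fun n => ?_
    simp only [θ]
    push_cast
    ring_nf
  let b : ℕ → ℝ := fun n => (1 - θ n) ^ (1 / α)
  let c : ℕ → ℝ := fun n => θ n ^ (1 / α)
  have hcont := Real.continuous_rpow_const (q := 1 / α) (by positivity)
  have hb : Tendsto b atTop (𝓝 1) := by
    have := (hcont.tendsto (1 - 0)).comp (hθ.const_sub 1)
    rwa [sub_zero, Real.one_rpow] at this
  have hc : Tendsto c atTop (𝓝 0) := by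
    have := (hcont.tendsto 0).comp hθ
    rwa [Real.zero_rpow (by positivity)] at this
  have hR := tendsto_lintegral_incr (ν := ν) (p := p) hf hN hb hc
  have hlim := hR.add_const (ENNReal.ofReal ((a + s) * stableConst α d) * levyEnergy α (ν ∗ p) f)
  rw [zero_add] at hlim
  refine ge_of_tendsto' hlim fun n => ?_
  have hpow : ∀ x : ℝ, 0 ≤ x → (x ^ (1 / α)) ^ α = x := fun x hx => by
    rw [← Real.rpow_mul hx, one_div_mul_cancel h0.ne', Real.rpow_one]
  have h1θ : 0 < 1 - θ n := sub_pos.2 (hθ1 n)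
  have hp1 : IsStableLaw α ((1 - θ n) * s) (p.map fun x => b n • x) :=
    hp.map_smul (Real.rpow_nonneg h1θ.le _) (hpow _ h1θ.le)
  have hp2 : IsStableLaw α (θ n * s) (p.map fun x => c n • x) :=
    hp.map_smul (Real.rpow_nonneg (hθ0 n).le _) (hpow _ (hθ0 n).le)
  have hpr1 : IsProbabilityMeasure (p.map fun x => b n • x) :=
    Measure.isProbabilityMeasure_map (measurable_const_smul _).aemeasurable
  have hpr2 : IsProbabilityMeasure (p.map fun x => c n • x) :=
    Measure.isProbabilityMeasure_map (measurable_const_smul _).aemeasurable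
  have hconv : ν ∗ p = (ν ∗ p.map fun x => b n • x) ∗ p.map fun x => c n • x := by
    rw [Measure.conv_assoc, hp.conv_eq hp1 hp2 (by ring)]
  have hs1 : 0 < (1 - θ n) * s := mul_pos h1θ hs
  have hLP := hν.conv ha hs1.le hC (hp1.lipPoincare hd h0 h2 hs1)
  obtain ⟨K, hK⟩ := hp2.exists_lipschitzWith_meanShift h0 h2 (mul_pos (hθ0 n) hs) hf hN
  calc ENNReal.ofReal (varOf (ν ∗ p) f)
      = ENNReal.ofReal (varOf ((ν ∗ p.map fun x => b n • x) ∗ p.map fun x => c n • x) f) := by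
        rw [← hconv]
    _ ≤ _ := ofReal_varOf_conv_le_incr hf.measurable hN
    _ ≤ _ := by
        refine add_le_add_right ?_ _
        refine (hLP _ N K (abs_meanShift_le hN) hK).trans ?_
        gcongr ?_ * ?_
        · refine ENNReal.ofReal_le_ofReal ?_
          gcongr
          exact mul_le_of_le_one_left hs.le (by linarith [hθ0 n])
        · rw [hconv]
          exact levyEnergy_meanShift_le hf.measurable hN

lemma abs_clip_sub_clip_le (N x y : ℝ) : |max (-N) (min x N) - max (-N) (min y N)| ≤ |x - y| :=
  (abs_max_sub_max_le_max _ _ _ _).trans (by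
    rw [sub_self, abs_zero, max_eq_right (abs_nonneg _)]
    refine (abs_min_sub_min_le_max _ _ _ _).trans ?_
    rw [sub_self, abs_zero, max_eq_left (abs_nonneg _)])

lemma abs_clip_le_abs {N : ℝ} (hN : 0 ≤ N) (x : ℝ) : |max (-N) (min x N)| ≤ |x| := by
  have := abs_clip_sub_clip_le N x 0
  simpa [hN] using this

lemma abs_clip_le {N : ℝ} (hN : 0 ≤ N) (x : ℝ) : |max (-N) (min x N)| ≤ N :=
  abs_le.2 ⟨le_max_left _ _, max_le (by linarith) (min_le_right _ _)⟩

lemma tendsto_clip (x : ℝ) : Tendsto (fun n : ℕ => max (-(n : ℝ)) (min x n)) atTop (𝓝 x) := by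
  obtain ⟨m, hm⟩ := exists_nat_ge |x|
  refine tendsto_const_nhds.congr' ?_
  filter_upwards [eventually_ge_atTop m] with n hn
  have h := abs_le.1 (hm.trans (Nat.cast_le.2 hn))
  rw [min_eq_left h.2, max_eq_right h.1]

lemma levyEnergy_clip_le {μ : Measure (Euc d)} (f : Euc d → ℝ) (N : ℝ) :
    levyEnergy α μ (fun x => max (-N) (min (f x) N)) ≤ levyEnergy α μ f := by
  refine lintegral_mono fun z => lintegral_mono fun x => ENNReal.ofReal_le_ofReal ?_
  gcongr ?_ / _
  exact sq_le_sq.2 (abs_clip_sub_clip_le N _ _)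

/-- Clipping `f` at height `n` does not increase the energy, being `1`-Lipschitz, and the variances
converge by domination by `f ^ 2` and `|f|`. -/
lemma LipPoincare.stablePoincare_conv [IsProbabilityMeasure ν] [IsProbabilityMeasure p]
    (hd : 0 < d) (h0 : 0 < α) (h2 : α < 2) (ha : 0 ≤ a) (hs : 0 < s) (hν : LipPoincare α ν a)
    (hp : IsStableLaw α s p) : StablePoincare α (ν ∗ p) (a + s) 0 := by
  intro f hf hf2
  rw [ENNReal.ofReal_zero, zero_mul, add_zero]
  let F : ℕ → Euc d → ℝ := fun n x => max (-(n : ℝ)) (min (f x) n)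
  have hfc : Continuous f := hf.continuous
  have hFc : ∀ n, Continuous (F n) := fun n => by unfold F; fun_prop
  have hFN : ∀ n x, |F n x| ≤ n := fun n x => abs_clip_le n.cast_nonneg _
  have hlim : ∀ x, Tendsto (fun n => F n x) atTop (𝓝 (f x)) := fun x => tendsto_clip _
  have hi1 : Integrable f (ν ∗ p) := hf2.integrable (by norm_num)
  have hi2 : Integrable (fun x => f x ^ 2) (ν ∗ p) := hf2.integrable_sq
  have hV : Tendsto (fun n => varOf (ν ∗ p) (F n)) atTop (𝓝 (varOf (ν ∗ p) f)) := by
    refine (tendsto_integral_of_dominated_convergence (fun x => f x ^ 2)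
      (fun n => ((hFc n).pow 2).aestronglyMeasurable) hi2 (fun n => .of_forall fun x => ?_)
      (.of_forall fun x => (hlim x).pow 2)).sub
      ((tendsto_integral_of_dominated_convergence (fun x => |f x|)
      (fun n => (hFc n).aestronglyMeasurable) hi1.abs (fun n => .of_forall fun x => ?_)
      (.of_forall fun x => hlim x)).pow 2)
    · rw [Pi.pow_apply, Real.norm_of_nonneg (sq_nonneg _)]
      exact sq_le_sq.2 (abs_clip_le_abs n.cast_nonneg _)
    · exact abs_clip_le_abs n.cast_nonneg _
  refine le_of_tendsto' ((ENNReal.continuous_ofReal.tendsto _).comp hV) fun n => ?_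
  refine (hν.conv_stable_of_continuous hd h0 h2 ha hs hp (hFc n) (hFN n)).trans ?_
  exact mul_le_mul_right (levyEnergy_clip_le f n) _

end Regularization

/-! ### Cocoercivity and contraction of a single gradient step. -/

section Gradient

variable {d : ℕ} {lam M : ℝ} {h : Euc d → ℝ}

lemma hasDerivAt_line (hh : Differentiable ℝ h) (x v : Euc d) (t : ℝ) :
    HasDerivAt (fun t : ℝ => h (x + t • v)) (inner ℝ (gradient h (x + t • v)) v) t := by
  have h1 := (hh (x + t • v)).hasGradientAt.hasFDerivAt
  have h2 : HasDerivAt (fun t : ℝ => x + t • v) v t := by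
    simpa using ((hasDerivAt_id t).smul_const v).const_add x
  simpa [Function.comp_def] using h1.comp_hasDerivAt t h2

/-- Along the segment, the function minus its quadratic upper model has nonpositive derivative, by
Cauchy–Schwarz and the Lipschitz gradient. -/
lemma IsSmoothWith.le_add (hh : IsSmoothWith M h) (x v : Euc d) :
    h (x + v) ≤ h x + inner ℝ (gradient h x) v + M / 2 * ‖v‖ ^ 2 := by
  let k : ℝ → ℝ := fun t => h (x + t • v) - (t * inner ℝ (gradient h x) v +
    M / 2 * ‖v‖ ^ 2 * t ^ 2)
  have hk : ∀ t, HasDerivAt k (inner ℝ (gradient h (x + t • v)) v -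
      (inner ℝ (gradient h x) v + M / 2 * ‖v‖ ^ 2 * (2 * t))) t := fun t => by
    refine (hasDerivAt_line hh.1 x v t).sub ?_
    refine (hasDerivAt_mul_const _).add ?_
    simpa using (hasDerivAt_pow 2 t).const_mul (M / 2 * ‖v‖ ^ 2)
  have hanti : AntitoneOn k (Set.Icc 0 1) := by
    refine antitoneOn_of_deriv_nonpos (convex_Icc 0 1)
      (fun t _ => (hk t).continuousAt.continuousWithinAt)
      (fun t _ => (hk t).differentiableAt.differentiableWithinAt) fun t ht => ?_
    rw [interior_Icc] at ht
    rw [(hk t).deriv]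
    have h1 : inner ℝ (gradient h (x + t • v)) v - inner ℝ (gradient h x) v ≤
        M * (t * ‖v‖) * ‖v‖ := by
      rw [← inner_sub_left]
      refine (real_inner_le_norm _ _).trans ?_
      gcongr
      have := hh.2 (x + t • v) x
      rwa [add_sub_cancel_left, norm_smul, Real.norm_of_nonneg ht.1.le] at this
    nlinarith
  have := hanti (Set.left_mem_Icc.2 zero_le_one) (Set.right_mem_Icc.2 zero_le_one) zero_le_one
  simp only [k, zero_smul, one_smul, add_zero] at this
  linarith

lemma StrongConvexOn.add_le (hc : StrongConvexOn Set.univ lam h) (hh : Differentiable ℝ h)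
    (x v : Euc d) :
    h x + inner ℝ (gradient h x) v + lam / 2 * ‖v‖ ^ 2 ≤ h (x + v) := by
  have hlim : Tendsto (fun t : ℝ => t⁻¹ * (h (x + t • v) - h x)) (𝓝[>] 0)
      (𝓝 (inner ℝ (gradient h x) v)) := by
    have := (hasDerivAt_line hh x v 0).tendsto_slope_zero_right
    simpa using this
  have hlim2 : Tendsto (fun t : ℝ => h (x + v) - h x - (1 - t) * (lam / 2 * ‖v‖ ^ 2)) (𝓝[>] 0)
      (𝓝 (h (x + v) - h x - (1 - 0) * (lam / 2 * ‖v‖ ^ 2))) := by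
    refine Tendsto.mono_left (Continuous.tendsto ?_ _) nhdsWithin_le_nhds
    fun_prop
  have := le_of_tendsto_of_tendsto hlim hlim2 ?_
  · linarith
  · filter_upwards [Ioc_mem_nhdsGT (zero_lt_one' ℝ)] with t ht
    have h1 := hc.2 (Set.mem_univ x) (Set.mem_univ (x + v)) (sub_nonneg.2 ht.2) ht.1.le
      (sub_add_cancel 1 t)
    rw [show (1 - t) • x + t • (x + v) = x + t • v by rw [sub_smul, one_smul, smul_add]; abel,
      show x - (x + v) = -v by abel, norm_neg, smul_eq_mul, smul_eq_mul] at h1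
    rw [inv_mul_le_iff₀ ht.1]
    linarith

/-- Cocoercivity of the gradient of a smooth strongly convex function. -/
lemma sq_norm_le_inner (hc : StrongConvexOn Set.univ lam h) (hh : IsSmoothWith M h) {L : ℝ}
    (hL : 0 < L) (hLM : M - lam ≤ L) (x y : Euc d) :
    ‖gradient h x - gradient h y - lam • (x - y)‖ ^ 2 ≤
      L * inner ℝ (x - y) (gradient h x - gradient h y - lam • (x - y)) := by
  have key : ∀ x y : Euc d, ‖gradient h x - gradient h y - lam • (x - y)‖ ^ 2 / (2 * L) ≤
      h x - h y - inner ℝ (gradient h y) (x - y) - lam / 2 * ‖x - y‖ ^ 2 := by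
    intro x y
    set v := gradient h x - gradient h y - lam • (x - y) with hv
    -- The upper model at `x` and the lower model at `y` are compared at the common point `x - L⁻¹ •
    -- v`, where `v` is the gradient difference of the convex function `h - lam / 2 * ‖·‖ ^ 2`.
    have h1 := hh.le_add x (-(L⁻¹ • v))
    have h2 := hc.add_le hh.1 y (x - y + -(L⁻¹ • v))
    rw [show y + (x - y + -(L⁻¹ • v)) = x + -(L⁻¹ • v) by abel] at h2
    have hg : gradient h x = gradient h y + lam • (x - y) + v := by rw [hv]; abel
    rw [hg] at h1
    have e1 : ‖x - y + -(L⁻¹ • v)‖ ^ 2 =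
        ‖x - y‖ ^ 2 - 2 * L⁻¹ * inner ℝ (x - y) v + L⁻¹ ^ 2 * ‖v‖ ^ 2 := by
      rw [norm_add_sq_real, inner_neg_right, real_inner_smul_right, norm_neg, norm_smul, mul_pow,
        Real.norm_eq_abs, sq_abs]
      ring
    have e2 : ‖-(L⁻¹ • v)‖ ^ 2 = L⁻¹ ^ 2 * ‖v‖ ^ 2 := by
      rw [norm_neg, norm_smul, mul_pow, Real.norm_eq_abs, sq_abs]
    rw [e2, inner_neg_right, real_inner_smul_right, inner_add_left, inner_add_left,
      real_inner_smul_left, real_inner_self_eq_norm_sq] at h1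
    rw [e1, inner_add_right, inner_neg_right, real_inner_smul_right] at h2
    have e3 : ‖v‖ ^ 2 / (2 * L) = L⁻¹ * ‖v‖ ^ 2 - L / 2 * (L⁻¹ ^ 2 * ‖v‖ ^ 2) := by
      field_simp; ring
    have h3 : (M - lam) / 2 * (L⁻¹ ^ 2 * ‖v‖ ^ 2) ≤ L / 2 * (L⁻¹ ^ 2 * ‖v‖ ^ 2) := by gcongr
    rw [e3]
    nlinarith
  have k1 := key x y
  have k2 := key y x
  have e : gradient h y - gradient h x - lam • (y - x) =
      -(gradient h x - gradient h y - lam • (x - y)) := by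
    rw [← neg_sub x y, smul_neg]; abel
  rw [e, norm_neg, norm_sub_rev y x, ← neg_sub x y, inner_neg_right] at k2
  have e2 : inner ℝ (x - y) (gradient h x - gradient h y - lam • (x - y)) =
      inner ℝ (gradient h x) (x - y) - inner ℝ (gradient h y) (x - y) - lam * ‖x - y‖ ^ 2 := by
    rw [real_inner_comm, inner_sub_left, inner_sub_left, real_inner_smul_left,
      real_inner_self_eq_norm_sq]
  rw [e2]
  -- The values of `h` cancel between the two orderings of the points.
  have hsum := add_le_add k1 k2
  rw [← add_div, div_le_iff₀ (by positivity)] at hsum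
  nlinarith

lemma lam_le_of_isSmoothWith (hd : 0 < d) (hc : StrongConvexOn Set.univ lam h)
    (hh : IsSmoothWith M h) : lam ≤ M := by
  let v : Euc d := EuclideanSpace.single ⟨0, hd⟩ 1
  have hv : ‖v‖ = 1 := by simp [v]
  have h1 := hh.le_add 0 v
  have h2 := hc.add_le hh.1 0 v
  rw [hv] at h1 h2
  linarith

/-- With `h - lam / 2 * ‖·‖ ^ 2` in place of `h`, the step is `(1 - η * lam) • (x - y) - η • v`, and
cocoercivity makes the `v` terms of its squared norm nonpositive. No Hessian is used. -/
lemma norm_gradient_step_sub_le (hlM : lam ≤ M)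
    (hc : StrongConvexOn Set.univ lam h) (hh : IsSmoothWith M h) {η : ℝ} (hη : 0 < η)
    (hηM : η * M ≤ 1) (x y : Euc d) :
    ‖x - y - η • (gradient h x - gradient h y)‖ ≤ (1 - η * lam) * ‖x - y‖ := by
  set v := gradient h x - gradient h y - lam • (x - y) with hv
  have hηl : η * lam ≤ η * M := by gcongr
  have e : x - y - η • (gradient h x - gradient h y) = (1 - η * lam) • (x - y) - η • v := by
    rw [hv, smul_sub η (_ - _) (lam • _), smul_smul, sub_smul, one_smul]; abel
  rw [e]
  rcases (hηl.trans hηM).lt_or_eq with hlt | heq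
  · have h1 := sq_norm_le_inner hc hh (L := 2 * (1 - η * lam) / η)
      (div_pos (by linarith) hη) (by rw [le_div_iff₀ hη]; nlinarith) x y
    rw [← hv, div_mul_eq_mul_div, le_div_iff₀ hη] at h1
    refine le_of_sq_le_sq ?_ (mul_nonneg (by linarith) (norm_nonneg _))
    rw [norm_sub_sq_real, norm_smul, norm_smul, real_inner_smul_left, real_inner_smul_right,
      Real.norm_of_nonneg hη.le, Real.norm_of_nonneg (by linarith : 0 ≤ 1 - η * lam), mul_pow,
      mul_pow]
    nlinarith
  -- When `η * lam = 1`, every `L > 0` is admissible, and `L → 0` forces `v = 0`.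
  · have hMl : M - lam ≤ 0 := by
      have : η * M ≤ η * lam := by linarith
      linarith [le_of_mul_le_mul_left this hη]
    have hv0 : ‖v‖ ^ 2 ≤ 0 := by
      have hcont : Tendsto (fun L : ℝ => L * inner ℝ (x - y) v) (𝓝[>] 0) (𝓝 0) := by
        have : Tendsto (fun L : ℝ => L * inner ℝ (x - y) v) (𝓝 0) (𝓝 (0 * inner ℝ (x - y) v)) :=
          (continuous_mul_const _).tendsto 0
        rw [zero_mul] at this
        exact this.mono_left nhdsWithin_le_nhds
      refine ge_of_tendsto hcont ?_
      filter_upwards [self_mem_nhdsWithin] with L hL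
      exact sq_norm_le_inner hc hh hL (hMl.trans (le_of_lt hL)) x y
    have hv1 : v = 0 := by
      have : ‖v‖ = 0 := pow_eq_zero_iff two_ne_zero |>.1 (le_antisymm hv0 (sq_nonneg _))
      exact norm_eq_zero.1 this
    rw [hv1, heq]
    simp

end Gradient

/-! ### Bi-Lipschitz bounds for the batch step. -/

section Batch

variable {d n : ℕ} {Z : Type*} {lam M η : ℝ} {ℓ : Euc d → Z → ℝ} {S : Fin n → Z}
  {B : Finset (Fin n)}

lemma batch_step_sub (hB : 0 < B.card) (x y : Euc d) :
    (x - η • batchGradient ℓ S B x) - (y - η • batchGradient ℓ S B y) =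
      (B.card : ℝ)⁻¹ • ∑ i ∈ B, (x - y - η • (gradient (fun w => ℓ w (S i)) x -
        gradient (fun w => ℓ w (S i)) y)) := by
  have hB0 : (B.card : ℝ) ≠ 0 := by positivity
  rw [Finset.sum_sub_distrib, Finset.sum_const, ← Finset.smul_sum, Finset.sum_sub_distrib, smul_sub,
    ← Nat.cast_smul_eq_nsmul ℝ, inv_smul_smul₀ hB0, smul_comm, smul_sub, smul_sub, batchGradient,
    batchGradient]
  abel

lemma norm_batch_step_sub_le (hB : 0 < B.card) (hlM : lam ≤ M)
    (hconv : ∀ z, StrongConvexOn Set.univ lam (fun w => ℓ w z))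
    (hsmooth : ∀ z, IsSmoothWith M (fun w => ℓ w z)) (hη : 0 < η) (hηM : η * M ≤ 1) (x y : Euc d) :
    ‖(x - η • batchGradient ℓ S B x) - (y - η • batchGradient ℓ S B y)‖ ≤
      (1 - η * lam) * ‖x - y‖ := by
  have hB0 : 0 < (B.card : ℝ) := by positivity
  rw [batch_step_sub hB, norm_smul, norm_inv, Real.norm_of_nonneg hB0.le, inv_mul_le_iff₀ hB0]
  refine (norm_sum_le_of_le B fun i _ => norm_gradient_step_sub_le hlM (hconv (S i))
    (hsmooth (S i)) hη hηM x y).trans_eq ?_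
  rw [Finset.sum_const, nsmul_eq_mul]

lemma le_norm_batch_step_sub (hB : 0 < B.card)
    (hsmooth : ∀ z, IsSmoothWith M (fun w => ℓ w z)) (hη : 0 < η) (x y : Euc d) :
    (1 - η * M) * ‖x - y‖ ≤
      ‖(x - η • batchGradient ℓ S B x) - (y - η • batchGradient ℓ S B y)‖ := by
  have hB0 : 0 < (B.card : ℝ) := by positivity
  have hg : ‖batchGradient ℓ S B x - batchGradient ℓ S B y‖ ≤ M * ‖x - y‖ := by
    rw [batchGradient, batchGradient, ← smul_sub, ← Finset.sum_sub_distrib, norm_smul, norm_inv,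
      Real.norm_of_nonneg hB0.le, inv_mul_le_iff₀ hB0]
    refine (norm_sum_le_of_le B fun i _ => (hsmooth (S i)).2 x y).trans_eq ?_
    rw [Finset.sum_const, nsmul_eq_mul]
  have e : (x - η • batchGradient ℓ S B x) - (y - η • batchGradient ℓ S B y) =
      (x - y) - η • (batchGradient ℓ S B x - batchGradient ℓ S B y) := by
    rw [smul_sub]; abel
  rw [e]
  have h1 := norm_sub_norm_le (x - y) (η • (batchGradient ℓ S B x - batchGradient ℓ S B y))
  rw [norm_smul, Real.norm_of_nonneg hη.le] at h1
  nlinarith [mul_le_mul_of_nonneg_left hg hη.le]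

end Batch

/-! ### The critical step size and the contraction factor. -/

section StepSize

variable {d : ℕ} {α lam M : ℝ}

lemma criticalStep_mul_eq (hα : 0 < α) (hlam : 0 < lam) (hM : 0 < M) :
    α * lam * M * criticalStep d α lam M = (α + d) * lam - d * M := by
  rw [criticalStep]
  field_simp

lemma criticalStep_pos (hd : 0 < d) (hα : 0 < α) (hlam : 0 < lam) (hM : 0 < M)
    (hcond : 1 < lam / M * (1 + α / d)) : 0 < criticalStep d α lam M := by
  have hd' : (0 : ℝ) < d := Nat.cast_pos.2 hd
  refine div_pos ?_ (by positivity)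
  rw [one_add_div hd'.ne', div_mul_div_comm, one_lt_div (by positivity)] at hcond
  linarith

/-- The definition gives `α * lam * (1 - η * M) = d * (M - lam)`, which is nonnegative. -/
lemma criticalStep_mul_le_one (hα : 0 < α) (hlam : 0 < lam) (hM : 0 < M)
    (hlM : lam ≤ M) : criticalStep d α lam M * M ≤ 1 := by
  have h := criticalStep_mul_eq (d := d) hα hlam hM
  have hd' : (0 : ℝ) ≤ d := Nat.cast_nonneg d
  have h2 : α * lam * (criticalStep d α lam M * M) ≤ α * lam * 1 := by nlinarith
  exact le_of_mul_le_mul_left h2 (by positivity)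

lemma contractionFactor_nonneg {η : ℝ} (hl : η * lam ≤ 1) (hM : η * M ≤ 1) :
    0 ≤ contractionFactor d α lam M η :=
  div_nonneg (Real.rpow_nonneg (by linarith) _) (pow_nonneg (by linarith) _)

lemma contractionFactor_eq_zero (hd : 0 < d) {η : ℝ} (hM : η * M = 1) :
    contractionFactor d α lam M η = 0 := by
  rw [contractionFactor, hM, sub_self, zero_pow hd.ne', div_zero]

/-- Bernoulli with exponent `(α + d) / d` bounds `(1 - η * lam)⁻¹` to that power strictly below by
`1 + (α + d) / d * (η * lam / (1 - η * lam))`. This equals `(1 - η * M)⁻¹` because `η` is critical.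
-/
lemma contractionFactor_criticalStep_lt_one (hd : 0 < d) (hα : 0 < α) (hlam : 0 < lam)
    (hM : 0 < M) (hlM : lam ≤ M) (hcond : 1 < lam / M * (1 + α / d)) :
    contractionFactor d α lam M (criticalStep d α lam M) < 1 := by
  have h0 := criticalStep_pos hd hα hlam hM hcond
  have h1 := criticalStep_mul_le_one (d := d) hα hlam hM hlM
  have he := criticalStep_mul_eq (d := d) hα hlam hM
  set η := criticalStep d α lam M
  rcases h1.eq_or_lt with h1 | h1
  · rw [contractionFactor_eq_zero hd h1]; exact one_pos
  have hd' : (0 : ℝ) < d := Nat.cast_pos.2 hd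
  have hl : η * lam ≤ η * M := by gcongr
  have hx : 0 < 1 - η * lam := by linarith
  have hy : 0 < 1 - η * M := by linarith
  rw [contractionFactor, div_lt_one (by positivity)]
  -- the Bernoulli inequality for the reciprocal of `1 - η λ`
  have hb := one_add_mul_self_lt_rpow_one_add (s := η * lam / (1 - η * lam))
    (by linarith [div_nonneg (mul_nonneg h0.le hlam.le) hx.le])
    (div_pos (mul_pos h0 hlam) hx).ne' (p := (α + d) / d) (by rw [one_lt_div hd']; linarith)
  have e1 : 1 + η * lam / (1 - η * lam) = (1 - η * lam)⁻¹ := by field_simp; ring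
  have e2 : 1 + (α + d) / d * (η * lam / (1 - η * lam)) = (1 - η * M)⁻¹ := by
    field_simp
    linear_combination (-η) * he
  rw [e1, e2, Real.inv_rpow hx.le] at hb
  have hlt := (inv_lt_inv₀ hy (Real.rpow_pos_of_pos hx _)).1 hb
  calc (1 - η * lam) ^ (α + d) = ((1 - η * lam) ^ ((α + d) / (d : ℝ))) ^ d := by
        rw [← Real.rpow_natCast, ← Real.rpow_mul hx.le, div_mul_cancel₀ _ hd'.ne']
    _ < (1 - η * M) ^ d := pow_lt_pow_left₀ hlt (Real.rpow_nonneg hx.le _) hd.ne'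

end StepSize

/-! ### Independence of iterate and noise, and the recursion for the laws. -/

section Independence

variable {Ω : Type*} [MeasurableSpace Ω] {P : Measure Ω}

variable {d n : ℕ} {Z : Type*} {ℓ : Euc d → Z → ℝ} {S : Fin n → Z} {B : ℕ → Finset (Fin n)}
  {α σ η : ℝ} {X ξ : ℕ → Ω → Euc d}

lemma IsHeavyTailedGD.measurable (hX : IsHeavyTailedGD P ℓ S B α σ η X ξ)
    (hg : ∀ k, Measurable (batchGradient ℓ S (B k))) (k : ℕ) : Measurable (X k) := by
  induction k with
  | zero => exact hX.measurable_init
  | succ k ih =>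
    rw [funext (hX.step k)]
    exact (ih.sub (((hg k).comp ih).const_smul η)).add
      ((hX.measurable_noise k).const_smul (σ * η ^ (1 / α)))

variable [IsProbabilityMeasure P]

/-- The joint law is a product of three factors; reassociating the product gives the claim. -/
lemma indepFun_prodMk_of_indepFun {A B C : Type*} [MeasurableSpace A] [MeasurableSpace B]
    [MeasurableSpace C] {U : Ω → A} {V : Ω → B} {W : Ω → C} (hU : Measurable U) (hV : Measurable V)
    (hW : Measurable W) (h1 : IndepFun U (fun ω => (V ω, W ω)) P) (h2 : IndepFun V W P) :
    IndepFun (fun ω => (U ω, V ω)) W P := by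
  have h3 : IndepFun U V P := h1.comp measurable_id measurable_fst
  have e1 := (indepFun_iff_map_prod_eq_prod_map_map hU.aemeasurable
    (hV.prodMk hW).aemeasurable).1 h1
  have e2 := (indepFun_iff_map_prod_eq_prod_map_map hV.aemeasurable hW.aemeasurable).1 h2
  have e3 := (indepFun_iff_map_prod_eq_prod_map_map hU.aemeasurable hV.aemeasurable).1 h3
  have hpU : IsProbabilityMeasure (P.map U) := Measure.isProbabilityMeasure_map hU.aemeasurable
  have hpV : IsProbabilityMeasure (P.map V) := Measure.isProbabilityMeasure_map hV.aemeasurable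
  have hpW : IsProbabilityMeasure (P.map W) := Measure.isProbabilityMeasure_map hW.aemeasurable
  rw [indepFun_iff_map_prod_eq_prod_map_map (hU.prodMk hV).aemeasurable hW.aemeasurable, e3,
    ← (measurePreserving_prodAssoc _ _ _).symm.map_eq, ← e2, ← e1,
    Measure.map_map (MeasurableEquiv.measurable _) (hU.prodMk (hV.prodMk hW))]
  rfl

/-- The iterate `X k` is a function of `X 0` and the noises with index below `k`, which are jointly
independent of `ξ k`. -/
lemma IsHeavyTailedGD.indepFun (hX : IsHeavyTailedGD P ℓ S B α σ η X ξ)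
    (hg : ∀ k, Measurable (batchGradient ℓ S (B k))) (k : ℕ) : IndepFun (X k) (ξ k) P := by
  let V : Ω → (Finset.range k → Euc d) := fun ω i => ξ i ω
  let W : Ω → Euc d × (Finset.range k → Euc d) := fun ω => (X 0 ω, V ω)
  have hV : Measurable V := measurable_pi_lambda _ fun i => hX.measurable_noise i
  have h1 : IndepFun (X 0) (fun ω => (V ω, ξ k ω)) P := by
    have hφ : Measurable fun f : ℕ → Euc d => ((fun i : Finset.range k => f i), f k) :=
      (measurable_pi_lambda _ fun i => measurable_pi_apply _).prodMk (measurable_pi_apply k)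
    exact hX.init_indep.comp measurable_id hφ
  have h2 : IndepFun V (ξ k) P := by
    have := hX.noise_indep.indepFun_finset (Finset.range k) {k} (by simp) hX.measurable_noise
    exact this.comp measurable_id
      (measurable_pi_apply (⟨k, Finset.mem_singleton_self k⟩ : ({k} : Finset ℕ)))
  have h3 : IndepFun W (ξ k) P :=
    indepFun_prodMk_of_indepFun hX.measurable_init hV (hX.measurable_noise k) h1 h2
  have hW : ∀ j ≤ k, Measurable[MeasurableSpace.comap W inferInstance] (X j) := by
    intro j
    induction j with
    | zero => exact fun _ => measurable_fst.comp (comap_measurable W)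
    | succ j ih =>
      intro hj
      have hj1 := ih (by omega)
      have hξ : Measurable[MeasurableSpace.comap W inferInstance] (ξ j) :=
        ((measurable_pi_apply (⟨j, Finset.mem_range.2 hj⟩ : Finset.range k)).comp
          measurable_snd).comp (comap_measurable W)
      rw [funext (hX.step j)]
      exact (hj1.sub (((hg j).comp hj1).const_smul η)).add (hξ.const_smul (σ * η ^ (1 / α)))
  rw [IndepFun_iff_Indep] at h3 ⊢
  exact indep_of_indep_of_le_left h3 (hW k le_rfl).comap_le

lemma IsHeavyTailedGD.map_succ (hX : IsHeavyTailedGD P ℓ S B α σ η X ξ)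
    (hg : ∀ k, Measurable (batchGradient ℓ S (B k))) (k : ℕ) :
    P.map (X (k + 1)) = ((P.map (X k)).map fun x => x - η • batchGradient ℓ S (B k) x) ∗
      ((P.map (ξ k)).map fun x => (σ * η ^ (1 / α)) • x) := by
  have hG : Measurable fun x => x - η • batchGradient ℓ S (B k) x :=
    measurable_id.sub ((hg k).const_smul η)
  have hs : Measurable fun x : Euc d => (σ * η ^ (1 / α)) • x := measurable_const_smul _
  have hXk := hX.measurable hg k
  have hξ := hX.measurable_noise k
  rw [Measure.map_map hG hXk, Measure.map_map hs hξ,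
    ← ((hX.indepFun hg k).comp hG hs).map_add_eq_map_conv_map (hG.comp hXk) (hs.comp hξ)]
  congr 1
  exact funext (hX.step k)

end Independence

/-! ### The main theorem. -/

lemma StablePoincare.mono {d : ℕ} {α a a' : ℝ} {μ : Measure (Euc d)} (hC : 0 ≤ stableConst α d)
    (h : StablePoincare α μ a 0) (ha : a ≤ a') : StablePoincare α μ a' 0 := by
  intro f hf hf2
  refine (h f hf hf2).trans ?_
  gcongr

lemma continuous_gradient_of_isSmoothWith {d : ℕ} {M : ℝ} {h : Euc d → ℝ} (hM : 0 ≤ M)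
    (hh : IsSmoothWith M h) : Continuous (gradient h) :=
  (LipschitzWith.of_dist_le_mul (K := ⟨M, hM⟩) fun x y => by
    rw [dist_eq_norm, dist_eq_norm]; exact hh.2 x y).continuous

theorem mainTheorem8 {Ω : Type*} [MeasurableSpace Ω] (P : Measure Ω) [IsProbabilityMeasure P]
    {Z : Type*} {d n b : ℕ} (hd : 0 < d) (hb : 0 < b)
    {α σ lam M γ : ℝ} (hα₁ : 1 < α) (hα₂ : α < 2) (hσ : 0 < σ)
    (hlam : 0 < lam) (hM : 0 < M) (hγ : 0 ≤ γ)
    (ℓ : EuclideanSpace ℝ (Fin d) → Z → ℝ)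
    (hconv : ∀ z, StrongConvexOn Set.univ lam (fun w => ℓ w z))
    (hsmooth : ∀ z, IsSmoothWith M (fun w => ℓ w z))
    (hcond : 1 < lam / M * (1 + α / d))
    (S : Fin n → Z) (B : ℕ → Finset (Fin n)) (hB : ∀ k, (B k).card = b) :
    contractionFactor d α lam M (criticalStep d α lam M) < 1 ∧
    ∀ η : ℝ,
      (η = criticalStep d α lam M ∨
        (0 < η ∧ η < 1 / M ∧ contractionFactor d α lam M η < 1)) →
      ∀ X ξ : ℕ → Ω → EuclideanSpace ℝ (Fin d),
        IsHeavyTailedGD P ℓ S B α σ η X ξ →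
        StablePoincare α (P.map (X 0)) γ 0 →
        γ ≤ poincareConst d α σ lam M η →
        ∀ k : ℕ, StablePoincare α (P.map (X k)) (poincareConst d α σ lam M η) 0 := by
  have hα : 0 < α := by linarith
  have hC := stableConst_nonneg (d := d) hα hα₂
  have hBc : ∀ k, 0 < (B k).card := fun k => by rw [hB k]; exact hb
  -- Derived from an actual loss in the batch, which exists because `b > 0`.
  have hlM : lam ≤ M := by
    obtain ⟨i, -⟩ := Finset.card_pos.1 (hBc 0)
    exact lam_le_of_isSmoothWith hd (hconv (S i)) (hsmooth (S i))
  have hF0 := contractionFactor_criticalStep_lt_one hd hα hlam hM hlM hcond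
  refine ⟨hF0, fun η hη X ξ hX hX0 hγc => ?_⟩
  obtain ⟨hη0, hηM, hF⟩ : 0 < η ∧ η * M ≤ 1 ∧ contractionFactor d α lam M η < 1 := by
    rcases hη with rfl | ⟨h1, h2, h3⟩
    · exact ⟨criticalStep_pos hd hα hlam hM hcond, criticalStep_mul_le_one hα hlam hM hlM, hF0⟩
    · exact ⟨h1, ((lt_div_iff₀ hM).1 h2).le, h3⟩
  have hηl : η * lam ≤ 1 := (mul_le_mul_of_nonneg_left hlM hη0.le).trans hηM
  set F := contractionFactor d α lam M η with hFdef
  have hFnn : 0 ≤ F := contractionFactor_nonneg hηl hηM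
  set c₀ := poincareConst d α σ lam M η with hc
  have hs : 0 < η * σ ^ α := by positivity
  have hc₀ : 0 ≤ c₀ := div_nonneg hs.le (by linarith)
  -- The constant `c₀` is the fixed point of the one-step recursion.
  have hfix : F * c₀ + η * σ ^ α = c₀ := by
    have : c₀ * (1 - F) = η * σ ^ α := div_mul_cancel₀ _ (by linarith)
    linarith
  have hg : ∀ k, Measurable (batchGradient ℓ S (B k)) := fun k => by
    refine Continuous.measurable ?_
    unfold batchGradient
    have hc : Continuous fun x => ∑ i ∈ B k, gradient (fun w => ℓ w (S i)) x :=
      continuous_finsetSum _ fun i _ => continuous_gradient_of_isSmoothWith hM.le (hsmooth (S i))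
    exact hc.const_smul ((B k).card : ℝ)⁻¹
  have hprob : ∀ k, IsProbabilityMeasure (P.map (X k)) := fun k =>
    Measure.isProbabilityMeasure_map (hX.measurable hg k).aemeasurable
  have hstep : ∀ k, LipPoincare α (P.map (X k)) c₀ →
      StablePoincare α (P.map (X (k + 1))) c₀ 0 := by
    intro k hk
    have hG : Measurable fun x => x - η • batchGradient ℓ S (B k) x :=
      measurable_id.sub ((hg k).const_smul η)
    have hGq := norm_batch_step_sub_le (S := S) (hBc k) hlM hconv hsmooth hη0 hηM
    have hGm := le_norm_batch_step_sub (S := S) (hBc k) hsmooth hη0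
    have hν : LipPoincare α ((P.map (X k)).map fun x => x - η • batchGradient ℓ S (B k) x)
        (F * c₀) := by
      rcases hηM.lt_or_eq with h | h
      · exact hk.map hα (by linarith) (by linarith) hGq hGm
      -- Equality `η * M = 1` can occur only at the critical step with `lam = M`. The gradient step
      -- is then constant, and its Dirac law satisfies the inequality with any constant.
      · have hlM' : η * lam = 1 := by
          have h0 := criticalStep_mul_eq (d := d) hα hlam hM
          rcases hη with h1 | ⟨-, h2, -⟩
          · rw [← h1] at h0
            have hd' : (0 : ℝ) < d := Nat.cast_pos.2 hd
            have : (d : ℝ) * (M - lam) = 0 := by linear_combination (-α * lam) * h + h0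
            have := (mul_eq_zero.1 this).resolve_left hd'.ne'
            rw [← h, sub_eq_zero.1 this]
          · exact absurd h ((lt_div_iff₀ hM).1 h2).ne
        have hconst : (fun x => x - η • batchGradient ℓ S (B k) x) =
            fun _ => (0 : Euc d) - η • batchGradient ℓ S (B k) 0 := by
          funext x
          have := hGq x 0
          rw [hlM', sub_self, zero_mul] at this
          exact sub_eq_zero.1 (norm_le_zero_iff.1 this)
        rw [hconst, Measure.map_const, measure_univ, one_smul]
        exact lipPoincare_dirac _ _
    have hp : IsStableLaw α (η * σ ^ α)
        ((P.map (ξ k)).map fun x => (σ * η ^ (1 / α)) • x) := by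
      have h1 : IsStableLaw α 1 (P.map (ξ k)) := fun t => by
        rw [hX.noise_law k t, one_mul]
      have := h1.map_smul (r := σ * η ^ (1 / α)) (θ := η * σ ^ α) (by positivity) (by
        rw [Real.mul_rpow hσ.le (by positivity), ← Real.rpow_mul hη0.le,
          one_div_mul_cancel hα.ne', Real.rpow_one, mul_comm])
      rwa [mul_one] at this
    have hpr1 : IsProbabilityMeasure
        ((P.map (X k)).map fun x => x - η • batchGradient ℓ S (B k) x) :=
      Measure.isProbabilityMeasure_map hG.aemeasurable
    have hpr2 : IsProbabilityMeasure (P.map (ξ k)) :=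
      Measure.isProbabilityMeasure_map (hX.measurable_noise k).aemeasurable
    have hpr3 : IsProbabilityMeasure ((P.map (ξ k)).map fun x => (σ * η ^ (1 / α)) • x) :=
      Measure.isProbabilityMeasure_map (measurable_const_smul _).aemeasurable
    rw [hX.map_succ hg k, ← hfix]
    exact hν.stablePoincare_conv hd hα hα₂ (mul_nonneg hFnn hc₀) hs hp
  intro k
  induction k with
  | zero => exact hX0.mono hC hγc
  -- Each step weakens to Lipschitz test functions before the gradient map; the noise restores the
  -- full class.
  | succ k ih => exact hstep k (ih.lipPoincare hd hα hα₂)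

end
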